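/- Let $\mathbb X$ be an effective orbifold of dimension $n$ with underlying paracompact Hausdorff space $\mathsf X$. Orbifold charts are triples $(V,\Gamma,\phi)$, where $V\subset\mathbb R^n$ is open and connected, $\Gamma$ is a finite group acting smoothly and effectively on $V$, and $\phi:V\to\mathsf X$ is a $\Gamma$-invariant continuous map inducing a homeomorphism of $V/\Gamma$ onto an open subset. Chart embeddings are pairs $(\psi,\theta)$, where $\psi$ is a smooth embedding with $\phi'\circ\psi=\phi$ and $\theta:\Gamma\to\Gamma'$ is an injective homomorphism for which $\psi$ is equivariant. For $x\in V$ put $\mathrm{Stab}(x)=\{\mu\in\Gamma:\mu x=x\}$. Let $f:\mathsf X\to\mathbb R$ be a stable Morse function. That is, in every chart $f\circ\phi$ is $C^2$ with nondegenerate critical points, and every critical point of $f$ has, in some chart, a lift $x$ such that $\mathrm{Stab}(x)$ acts trivially on the negative eigenspace of the Hessian of $f\circ\phi$ at $x$ (taken with respect to a $\mathrm{Stab}(x)$-invariant inner product). Let $g$ be a $C^1$ Riemannian metric on $\mathbb X$, i.e. a $\Gamma$-invariant metric on each chart, compatible with all chart embeddings. Let $p,q$ be critical points of $f$. A flow line from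 $p$ to $q$ is a continuous map $\gamma:\mathbb R\to\mathsf X$ that locally lifts to every chart it meets, all of whose local lifts are negative gradient trajectories, and with $\gamma(-\infty)=p$ and $\gamma(+\infty)=q$; $\mathcal M(p,q)$ is the set of flow lines from $p$ to $q$ modulo translation. Let $\tilde p\in V$ and $\tilde q\in V'$ be lifts of $p$ and $q$ to arbitrary charts $(V,\Gamma,\phi)$ and $(V',\Gamma',\phi')$. 1. Let $\gamma$ be a flow line from $p$ to $q$. Then $\gamma$ induces an injective homomorphism $\iota:\mathrm{Stab}(\tilde p)\to\mathrm{Stab}(\tilde q)$, which is canonical in the sense that it is unique up to conjugation by an element of $\mathrm{Stab}(\tilde q)$. Here a homomorphism $\iota$ is induced by $\gamma$ if there are a lift $\alpha$ of $\gamma|_{(-\infty,s]}$ to $V$ with limit $\tilde p$ at $-\infty$ and a lift $\beta$ of $\gamma|_{[t,\infty)}$ to $V'$ with limit $\tilde q$ at $+\infty$ such that $\mathrm{Stab}(\tilde p)=\mathrm{Stab}(\alpha(s))$ in $\Gamma$, $\mathrm{Stab}(\beta(t))\subset\mathrm{Stab}(\tilde q)$ in $\Gamma'$, and $\iota$ is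 a transport $\mathrm{Stab}(\alpha(s))\cong\mathrm{Stab}(\beta(t))$ along $\gamma$ followed by this inclusion. The transports along $\gamma$ are the isomorphisms generated, under composition and inversion, by the identity identification $\mathrm{Stab}(\tilde\gamma(s_1))=\mathrm{Stab}(\tilde\gamma(s_2))$ for a continuous lift $\tilde\gamma$ of $\gamma|_{[s_1,s_2]}$ to one chart, and by the isomorphisms $\theta:\mathrm{Stab}(z)\cong\mathrm{Stab}(\psi(z))$ for a chart embedding $(\psi,\theta)$ and a lift $z$ of a point of $\gamma$. 2. If there is a flow line from $p$ to $q$, then $|\mathrm{Stab}(\tilde p)|$ divides $|\mathrm{Stab}(\tilde q)|$. 3. If $\mathcal M(p,q)$ is finite, then for every choice of signs $o_{[\gamma]}\in\{1,-1\}$ the coefficient $$\sum_{[\gamma]\in\mathcal M(p,q)} o_{[\gamma]}\,\frac{|\mathrm{Stab}(\tilde q)|}{|\mathrm{Stab}(\tilde p)|}$$ of the invariant differential is an integer. -/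

import Mathlib

open Set Filter Topology
open scoped ContDiff

namespace OrbifoldMorse

/-- The model space `ℝⁿ`. -/
abbrev E (n : ℕ) : Type := EuclideanSpace ℝ (Fin n)

/-- An `n`-dimensional orbifold chart `(V, Γ, φ)` on the space `X`. The action and `φ` are total
functions for convenience; only their restrictions to `V` carry information. -/
structure OrbifoldChart (X : Type*) [TopologicalSpace X] (n : ℕ) where
  V : Set (E n)
  isOpen_V : IsOpen V
  isConnected_V : IsConnected V
  Γ : Type
  [group : Group Γ]
  [finite : Finite Γ]
  [action : MulAction Γ (E n)]
  smul_mem : ∀ (μ : Γ), ∀ x ∈ V, μ • x ∈ V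
  smooth_smul : ∀ μ : Γ, ContDiffOn ℝ ∞ (fun x : E n => μ • x) V
  effective : ∀ μ : Γ, (∀ x ∈ V, μ • x = x) → μ = 1
  φ : E n → X
  continuousOn_φ : ContinuousOn φ V
  /-- The fibres of `φ` on `V` are exactly the orbits, so `V / Γ → X` is well defined and
  injective. -/
  φ_eq_iff : ∀ x ∈ V, ∀ y ∈ V, φ x = φ y ↔ ∃ μ : Γ, μ • x = y
  /-- `φ` is open, so `V / Γ → X` is a homeomorphism onto an open subset. -/
  isOpenMap_φ : IsOpenMap (V.domRestrict φ)

attribute [instance] OrbifoldChart.group OrbifoldChart.finite OrbifoldChart.action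

section Basic

variable {X : Type*} [TopologicalSpace X] {n : ℕ}

/-- The open subset of `X` uniformized by a chart. -/
def OrbifoldChart.range (c : OrbifoldChart X n) : Set X := c.φ '' c.V

/-- The stabilizer `Stab(x) ⊂ Γ` of a point of a chart. -/
abbrev OrbifoldChart.Stab (c : OrbifoldChart X n) (x : E n) : Subgroup c.Γ :=
  MulAction.stabilizer c.Γ x

/-- An embedding `(ψ, θ) : (V, Γ, φ) → (V', Γ', φ')` of orbifold charts. -/
structure ChartEmbedding (c d : OrbifoldChart X n) where
  ψ : E n → E n
  mapsTo : MapsTo ψ c.V d.V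
  smooth : ContDiffOn ℝ ∞ ψ c.V
  isEmbedding : IsEmbedding (c.V.domRestrict ψ)
  immersion : ∀ x ∈ c.V, Function.Injective (fderiv ℝ ψ x)
  comp_eq : ∀ x ∈ c.V, d.φ (ψ x) = c.φ x
  θ : c.Γ →* d.Γ
  injective_θ : Function.Injective θ
  equivariant : ∀ (μ : c.Γ), ∀ x ∈ c.V, ψ (μ • x) = θ μ • ψ x

/-- Local compatibility of two charts. -/
def Compatible (c d : OrbifoldChart X n) : Prop :=
  ∀ x ∈ c.range ∩ d.range, ∃ e : OrbifoldChart X n, x ∈ e.range ∧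
    Nonempty (ChartEmbedding e c) ∧ Nonempty (ChartEmbedding e d)

end Basic

/-- An effective `n`-dimensional orbifold structure on `X`, given by its maximal orbifold atlas.
(In a maximal atlas the small charts that witness compatibility belong to the atlas.) -/
structure EffectiveOrbifold (X : Type*) [TopologicalSpace X] (n : ℕ) where
  charts : Set (OrbifoldChart X n)
  covers : ∀ x : X, ∃ c ∈ charts, x ∈ c.range
  compatible : ∀ c ∈ charts, ∀ d ∈ charts, ∀ x ∈ c.range ∩ d.range, ∃ e ∈ charts, x ∈ e.range ∧
    Nonempty (ChartEmbedding e c) ∧ Nonempty (ChartEmbedding e d)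
  maximal : ∀ c : OrbifoldChart X n, (∀ d ∈ charts, Compatible c d) → c ∈ charts

namespace EffectiveOrbifold

variable {X : Type*} [TopologicalSpace X] {n : ℕ}

section Functions

/-- The local representative `f_V = f ∘ φ`. -/
def rep (c : OrbifoldChart X n) (f : X → ℝ) : E n → ℝ := f ∘ c.φ

/-- The second derivative of the local representative, as a bilinear form. At a critical point it
is the Hessian. -/
noncomputable def hess (c : OrbifoldChart X n) (f : X → ℝ) (x : E n) : E n →L[ℝ] E n →L[ℝ] ℝ :=
  fderiv ℝ (fderiv ℝ (rep c f)) x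

/-- `f` is Morse: each local representative is `C²` with nondegenerate critical points. -/
def IsMorse (O : EffectiveOrbifold X n) (f : X → ℝ) : Prop :=
  ∀ c ∈ O.charts, ContDiffOn ℝ 2 (rep c f) c.V ∧
    ∀ x ∈ c.V, fderiv ℝ (rep c f) x = 0 → ∀ v, (∀ w, hess c f x v w = 0) → v = 0

/-- `p` is a critical point of `f`. -/
def IsCritical (O : EffectiveOrbifold X n) (f : X → ℝ) (p : X) : Prop :=
  ∃ c ∈ O.charts, ∃ x ∈ c.V, c.φ x = p ∧ fderiv ℝ (rep c f) x = 0

/-- `a` is an inner product on `ℝⁿ`. -/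
def IsInnerProduct (a : E n →L[ℝ] E n →L[ℝ] ℝ) : Prop :=
  (∀ v w, a v w = a w v) ∧ ∀ v, v ≠ 0 → 0 < a v v

/-- The span of the eigenvectors with negative eigenvalue of the bilinear form `B` with respect to
the inner product `a`. -/
def negEigenspace (a B : E n →L[ℝ] E n →L[ℝ] ℝ) : Submodule ℝ (E n) :=
  Submodule.span ℝ {v | ∃ l : ℝ, l < 0 ∧ ∀ w, B v w = l * a v w}

/-- `p` is stable for `f`: for some chart and some lift `x` of `p`, `Stab(x)` acts trivially on the
negative eigenspace of the Hessian at `x`. The eigenspace is taken with respect to an inner product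
on the tangent space that is invariant under `Stab(x)`, so that `Stab(x)` acts on it. -/
def IsStableAt (O : EffectiveOrbifold X n) (f : X → ℝ) (p : X) : Prop :=
  ∃ c ∈ O.charts, ∃ x ∈ c.V, c.φ x = p ∧ ∃ a : E n →L[ℝ] E n →L[ℝ] ℝ, IsInnerProduct a ∧
    (∀ μ ∈ c.Stab x, ∀ v w, a (fderiv ℝ (fun z : E n => μ • z) x v)
      (fderiv ℝ (fun z : E n => μ • z) x w) = a v w) ∧
    ∀ μ ∈ c.Stab x, ∀ v ∈ negEigenspace a (hess c f x), fderiv ℝ (fun z : E n => μ • z) x v = v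

/-- `f` is a stable Morse function. -/
def IsStableMorse (O : EffectiveOrbifold X n) (f : X → ℝ) : Prop :=
  O.IsMorse f ∧ ∀ p, O.IsCritical f p → O.IsStableAt f p

end Functions

/-- A (`C¹`) Riemannian metric on the orbifold: an invariant Riemannian metric on every chart of
the maximal atlas, compatible with all embeddings of charts. -/
structure RiemannianMetric (O : EffectiveOrbifold X n) where
  inner : OrbifoldChart X n → E n → E n →L[ℝ] E n →L[ℝ] ℝ
  contDiffOn : ∀ c ∈ O.charts, ContDiffOn ℝ 1 (inner c) c.V
  isInnerProduct : ∀ c ∈ O.charts, ∀ x ∈ c.V, IsInnerProduct (inner c x)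
  invariant : ∀ c ∈ O.charts, ∀ (μ : c.Γ), ∀ x ∈ c.V, ∀ v w,
    inner c (μ • x) (fderiv ℝ (fun z : E n => μ • z) x v) (fderiv ℝ (fun z : E n => μ • z) x w) =
      inner c x v w
  pullback : ∀ c ∈ O.charts, ∀ d ∈ O.charts, ∀ (j : ChartEmbedding c d), ∀ x ∈ c.V, ∀ v w,
    inner d (j.ψ x) (fderiv ℝ j.ψ x v) (fderiv ℝ j.ψ x w) = inner c x v w

section FlowLines

/-- `β` is a continuous lift of `γ` to the chart `c` over the set `I` of times. -/
def IsLift (c : OrbifoldChart X n) (γ : ℝ → X) (I : Set ℝ) (β : ℝ → E n) : Prop :=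
  ContinuousOn β I ∧ ∀ s ∈ I, β s ∈ c.V ∧ c.φ (β s) = γ s

/-- `v` is the value at `x` of the negative gradient of the local representative of `f`. -/
def IsNegGrad {O : EffectiveOrbifold X n} (g : O.RiemannianMetric) (f : X → ℝ)
    (c : OrbifoldChart X n) (x v : E n) : Prop :=
  ∀ w, g.inner c x v w = -(fderiv ℝ (rep c f) x w)

/-- `γ` is a Morse flow line of `f` from `p` to `q`: it is continuous, it can be lifted locally to
every chart that it meets, each local lift is a negative gradient trajectory, and the limits at
`-∞` and `+∞` are `p` and `q`. -/
structure IsFlowLine {O : EffectiveOrbifold X n} (g : O.RiemannianMetric) (f : X → ℝ) (p q : X)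
    (γ : ℝ → X) : Prop where
  continuous : Continuous γ
  exists_lift : ∀ c ∈ O.charts, ∀ s, γ s ∈ c.range →
    ∃ ε > 0, ∃ β, IsLift c γ (Ioo (s - ε) (s + ε)) β
  flow : ∀ c ∈ O.charts, ∀ I : Set ℝ, IsOpen I → ∀ β, IsLift c γ I β →
    ∀ s ∈ I, ∃ v, HasDerivAt β v s ∧ IsNegGrad g f c (β s) v
  tendsto_atBot : Tendsto γ atBot (𝓝 p)
  tendsto_atTop : Tendsto γ atTop (𝓝 q)

/-- Two flow lines are equivalent if they differ by a translation of time. -/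
def flowLineSetoid {O : EffectiveOrbifold X n} (g : O.RiemannianMetric) (f : X → ℝ) (p q : X) :
    Setoid {γ : ℝ → X // IsFlowLine g f p q γ} where
  r γ γ' := ∃ τ : ℝ, ∀ s, γ'.1 s = γ.1 (s + τ)
  iseqv :=
    { refl := fun _ => ⟨0, fun s => by simp⟩
      symm := fun {_ _} ⟨τ, h⟩ => ⟨-τ, fun s => by simp [h]⟩
      trans := fun {_ _ _} ⟨τ, h⟩ ⟨σ, k⟩ => ⟨σ + τ, fun s => by rw [k, h, add_assoc]⟩ }

/-- The moduli space `M(p, q)` of flow lines from `p` to `q` up to translation. -/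
def Moduli {O : EffectiveOrbifold X n} (g : O.RiemannianMetric) (f : X → ℝ) (p q : X) : Type _ :=
  Quotient (flowLineSetoid g f p q)

end FlowLines

section Transport

/-- A lift of the point `γ s` to a chart. -/
structure LiftPoint (O : EffectiveOrbifold X n) (γ : ℝ → X) where
  chart : OrbifoldChart X n
  chart_mem : chart ∈ O.charts
  time : ℝ
  pt : E n
  pt_mem : pt ∈ chart.V
  φ_pt : chart.φ pt = γ time

/-- The lift of `γ s` given by a lift of the path `γ`. -/
def LiftPoint.ofLift {O : EffectiveOrbifold X n} {γ : ℝ → X} {c : OrbifoldChart X n}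
    (hc : c ∈ O.charts) {I : Set ℝ} {β : ℝ → E n} (hβ : IsLift c γ I β) (s : ℝ) (hs : s ∈ I) :
    LiftPoint O γ :=
  ⟨c, hc, s, β s, (hβ.2 s hs).1, (hβ.2 s hs).2⟩

/-- The image of a lift of `γ s` under an embedding of charts. -/
def LiftPoint.map {O : EffectiveOrbifold X n} {γ : ℝ → X} (a : LiftPoint O γ)
    {d : OrbifoldChart X n} (hd : d ∈ O.charts) (j : ChartEmbedding a.chart d) : LiftPoint O γ :=
  ⟨d, hd, a.time, j.ψ a.pt, j.mapsTo a.pt_mem, (j.comp_eq _ a.pt_mem).trans a.φ_pt⟩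

/-- The stabilizer of a lift of `γ s` in the group of its chart. -/
abbrev LiftPoint.Stab {O : EffectiveOrbifold X n} {γ : ℝ → X} (a : LiftPoint O γ) :
    Subgroup a.chart.Γ :=
  a.chart.Stab a.pt

/-- The isomorphisms between stabilizers of lifts of points of `γ` that are induced by transport
along `γ`. They are generated by two kinds: inside one chart, along a lift `β` of `γ`, the
stabilizers of `β s` and `β t` are identified as subgroups of `Γ`; under an embedding
`(ψ, θ)` of charts, the stabilizers of `x` and `ψ x` are identified through `θ`. -/
inductive IsTransport (O : EffectiveOrbifold X n) (γ : ℝ → X) :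
    (a b : LiftPoint O γ) → (a.Stab ≃* b.Stab) → Prop
  | along (c : OrbifoldChart X n) (hc : c ∈ O.charts) (s t : ℝ) (hst : s ≤ t) (β : ℝ → E n)
      (hβ : IsLift c γ (Icc s t) β)
      (e : c.Stab (β s) ≃* c.Stab (β t)) (he : ∀ μ, (e μ : c.Γ) = μ) :
      IsTransport O γ (LiftPoint.ofLift hc hβ s (left_mem_Icc.2 hst))
        (LiftPoint.ofLift hc hβ t (right_mem_Icc.2 hst)) e
  | embed (a : LiftPoint O γ) (d : OrbifoldChart X n) (hd : d ∈ O.charts)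
      (j : ChartEmbedding a.chart d) (e : a.chart.Stab a.pt ≃* d.Stab (j.ψ a.pt))
      (he : ∀ μ, (e μ : d.Γ) = j.θ μ) :
      IsTransport O γ a (a.map hd j) e
  | symm {a b : LiftPoint O γ} {e : a.Stab ≃* b.Stab} :
      IsTransport O γ a b e → IsTransport O γ b a e.symm
  | trans {a b c : LiftPoint O γ} {e : a.Stab ≃* b.Stab} {e' : b.Stab ≃* c.Stab} :
      IsTransport O γ a b e → IsTransport O γ b c e' → IsTransport O γ a c (e.trans e')

/-- `ι : Stab(x) → Stab(y)` is the homomorphism induced by `γ`, where `x` and `y` are lifts of the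
limits of `γ` at `-∞` and `+∞`. Let `α` be a lift of `γ` near `-∞` with limit `x`, and `β` a lift
of `γ` near `+∞` with limit `y`. Then `Stab(x) = Stab(α s)` inside `Γ_c`, and `ι` is a transport
`Stab(α s) ≃ Stab(β t)` along `γ`, followed by the inclusion of `Stab(β t)` into `Stab(y)` inside
`Γ_d`. -/
def IsInducedBy (O : EffectiveOrbifold X n) (γ : ℝ → X) {c d : OrbifoldChart X n}
    (hc : c ∈ O.charts) (hd : d ∈ O.charts) {x y : E n} (ι : c.Stab x →* d.Stab y) : Prop :=
  ∃ (s t : ℝ) (α β : ℝ → E n) (hα : IsLift c γ (Iic s) α) (hβ : IsLift d γ (Ici t) β),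
    Tendsto α atBot (𝓝 x) ∧ Tendsto β atTop (𝓝 y) ∧
    ∃ (h : c.Stab x = c.Stab (α s)) (e : c.Stab (α s) ≃* d.Stab (β t)),
      IsTransport O γ (LiftPoint.ofLift hc hα s self_mem_Iic)
        (LiftPoint.ofLift hd hβ t self_mem_Ici) e ∧
      ∀ μ : c.Stab x, (ι μ : d.Γ) = e ⟨μ, h ▸ μ.2⟩

end Transport

/-- The coefficient `∑_{[γ] ∈ M(p, q)} o_{[γ]} |Stab(q)| / |Stab(p)|` of `q` in the invariant
differential of `p`, for given signs `o`; the stabilizers are those of the lifts `x` of `p` and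
`y` of `q`. -/
noncomputable def invariantCoeff {O : EffectiveOrbifold X n} (g : O.RiemannianMetric) (f : X → ℝ)
    (p q : X) (c d : OrbifoldChart X n) (x y : E n) (o : Moduli g f p q → ℤˣ) : ℚ :=
  ∑ᶠ m : Moduli g f p q, ((o m : ℤ) : ℚ) * ((Nat.card (d.Stab y) : ℚ) / Nat.card (c.Stab x))

end EffectiveOrbifold

end OrbifoldMorse

/-! The analytic heart is that a flow line leaving a stable critical point stays in the fixed locus
of its isotropy group. Take a lift `α` with `α → x` at `-∞`, `μ ∈ Stab(x)`, and `W = μα - α`, a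
difference of two negative gradient trajectories. To first order `W` lies in the moving part of the
isotropy representation, the range of `∑ (dν - 1)`. Negative eigenvectors of the Hessian are fixed
by `Stab(x)`, so the moving part is orthogonal to them and the Hessian is positive there. Hence
`G(W, W)`, with `G` the metric at `x`, is nonincreasing near `-∞`; as it tends to `0` there, `W`
vanishes (`eventually_apply_nonpos`, `IsFlowLine.stab_le_of_tendsto_atBot`). By uniqueness for the
gradient ODE the stabilizer is constant along a lift, so `Stab(x) = Stab(α s)`. At the other end
semicontinuity of stabilizers gives `Stab(β t) ≤ Stab(y)`. Transport in between yields the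
injection, and Lagrange gives divisibility and integrality.

Canonicity is a statement about monodromy: a transport is an arbitrary word in the generators, and
may run back and forth in time. The ambiguity of changing charts at one time is an inner
automorphism, because two embeddings of the same charts differ by an element of the target group
(`ChartEmbedding.exists_eq_smul`). Since an interval has no loops, one can choose over it a coherent
class of labellings of all stabilizers, unique up to conjugation (`IsPotential`). Every transport
preserves it, so any two transports between the same lifts differ by a conjugation. -/

namespace OrbifoldMorse

variable {X : Type*} [TopologicalSpace X] {n : ℕ}

/-! ### Rigidity of the finite group action in a chart. -/

namespace OrbifoldChart

variable (c : OrbifoldChart X n)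

/-- The derivative at `x` of the action of `μ`. -/
noncomputable abbrev dsmul (μ : c.Γ) (x : E n) : E n →L[ℝ] E n :=
  fderiv ℝ (fun z : E n => μ • z) x

variable {c}

lemma contDiffAt_smul (μ : c.Γ) {x : E n} (hx : x ∈ c.V) :
    ContDiffAt ℝ ∞ (fun z : E n => μ • z) x :=
  (c.smooth_smul μ).contDiffAt (c.isOpen_V.mem_nhds hx)

lemma hasStrictFDerivAt_smul (μ : c.Γ) {x : E n} (hx : x ∈ c.V) :
    HasStrictFDerivAt (fun z : E n => μ • z) (c.dsmul μ x) x :=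
  (contDiffAt_smul μ hx).hasStrictFDerivAt (by simp)

lemma continuousAt_smul (μ : c.Γ) {x : E n} (hx : x ∈ c.V) :
    ContinuousAt (fun z : E n => μ • z) x :=
  (contDiffAt_smul μ hx).continuousAt

lemma dsmul_mul (μ ν : c.Γ) {x : E n} (hx : x ∈ c.V) :
    c.dsmul (μ * ν) x = (c.dsmul μ (ν • x)).comp (c.dsmul ν x) := by
  have h := (hasStrictFDerivAt_smul μ (c.smul_mem ν x hx)).hasFDerivAt.comp x
    (hasStrictFDerivAt_smul ν hx).hasFDerivAt
  have e : (fun z : E n => (μ * ν) • z) = (fun z : E n => μ • z) ∘ fun z : E n => ν • z := by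
    funext z; simp [mul_smul]
  rw [dsmul, e, h.fderiv]

lemma dsmul_one (x : E n) : c.dsmul 1 x = ContinuousLinearMap.id ℝ (E n) := by
  simp [dsmul]

lemma φ_smul (μ : c.Γ) {x : E n} (hx : x ∈ c.V) : c.φ (μ • x) = c.φ x :=
  ((c.φ_eq_iff x hx _ (c.smul_mem μ x hx)).2 ⟨μ, rfl⟩).symm

/-- Each power of `μ` has derivative `1` at `x`, so strict differentiability gives `μ^j(μz) - μ^j z
= (μz - z) + o(μz - z)`. Summed over one period the left side telescopes to `0`, while the right
side is `orderOf μ` times `μz - z`, up to a smaller error; this forces `μz = z`. -/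
lemma eventually_smul_eq {μ : c.Γ} {x : E n} (hx : x ∈ c.V) (hfix : μ • x = x)
    (hD : c.dsmul μ x = ContinuousLinearMap.id ℝ (E n)) : ∀ᶠ z in 𝓝 x, μ • z = z := by
  have hpow : ∀ j : ℕ, μ ^ j • x = x ∧ c.dsmul (μ ^ j) x = ContinuousLinearMap.id ℝ (E n) := by
    intro j
    induction j with
    | zero => exact ⟨by simp, by rw [pow_zero, dsmul_one]⟩
    | succ j ih =>
      refine ⟨by rw [pow_succ, mul_smul, hfix, ih.1], ?_⟩
      rw [pow_succ, dsmul_mul _ _ hx, hfix, ih.2, hD, ContinuousLinearMap.id_comp]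
  have hlim : Tendsto (fun z : E n => (μ • z, z)) (𝓝 x) (𝓝 (x, x)) := by
    have h1 := continuousAt_smul μ hx
    rw [ContinuousAt, hfix] at h1
    exact h1.prodMk_nhds tendsto_id
  have hsum : (fun z : E n => ∑ j ∈ Finset.range (orderOf μ),
      (μ ^ j • μ • z - μ ^ j • z - (μ • z - z))) =o[𝓝 x] fun z : E n => μ • z - z := by
    refine Asymptotics.IsLittleO.fun_sum fun j _ => ?_
    have h := (hasStrictFDerivAt_smul (μ ^ j) hx).isLittleO
    rw [(hpow j).2] at h
    exact h.comp_tendsto hlim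
  have hk : 1 ≤ orderOf μ := orderOf_pos μ
  have hk' : (1 : ℝ) ≤ orderOf μ := by exact_mod_cast hk
  filter_upwards [hsum.bound (show (0 : ℝ) < 1 / 2 by norm_num)] with z hz
  have htel : ∑ j ∈ Finset.range (orderOf μ), (μ ^ j • μ • z - μ ^ j • z - (μ • z - z)) =
      -((orderOf μ : ℝ) • (μ • z - z)) := by
    rw [Finset.sum_sub_distrib]
    have : ∀ j, μ ^ j • μ • z = μ ^ (j + 1) • z := fun j => by rw [pow_succ, mul_smul]
    simp only [this]
    rw [Finset.sum_range_sub (fun j => μ ^ j • z)]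
    simp [pow_orderOf_eq_one, Nat.cast_smul_eq_nsmul, smul_sub]
  rw [htel, norm_neg, norm_smul, Real.norm_natCast] at hz
  have h0 : ‖μ • z - z‖ = 0 := by
    have := norm_nonneg (μ • z - z)
    nlinarith
  exact sub_eq_zero.1 (norm_eq_zero.1 h0)

/-- An element of the group of a chart is determined by its `1`-jet at a fixed point. -/
lemma eq_one_of_dsmul_eq_id {μ : c.Γ} {x : E n} (hx : x ∈ c.V) (hfix : μ • x = x)
    (hD : c.dsmul μ x = ContinuousLinearMap.id ℝ (E n)) : μ = 1 := by
  apply c.effective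
  let U : Set (E n) := {y | ∀ᶠ z in 𝓝 y, μ • z = z}
  have hU : IsOpen U := isOpen_setOfPred_eventually_nhds
  -- The 1-jet of `μ` is continuous, so it is still that of the identity at limit points of `U`; the
  -- local lemma puts these back into `U`, and connectedness finishes.
  have hsub : c.V ⊆ U := by
    refine c.isConnected_V.isPreconnected.subset_of_closure_inter_subset hU
      ⟨x, hx, eventually_smul_eq hx hfix hD⟩ ?_
    rintro y ⟨hyU, hy⟩
    have hev : ∃ᶠ z in 𝓝 y, z ∈ U := mem_closure_iff_frequently.1 hyU
    have hc1 : ContinuousAt (fun z : E n => μ • z - z) y := (continuousAt_smul μ hy).sub continuousAt_id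
    have hc2 : ContinuousAt (fun z : E n => c.dsmul μ z) y :=
      ((contDiffAt_smul μ hy).fderiv_right (m := 0) (by simp)).continuousAt
    refine eventually_smul_eq hy ?_ ?_
    · have : ∃ᶠ z in 𝓝 y, (fun z : E n => μ • z - z) z ∈ ({0} : Set (E n)) :=
        hev.mono fun z hz => by simp [hz.self_of_nhds]
      have := isClosed_singleton.mem_of_frequently_of_tendsto this hc1
      exact sub_eq_zero.1 this
    · have : ∃ᶠ z in 𝓝 y, c.dsmul μ z ∈ ({ContinuousLinearMap.id ℝ (E n)} : Set _) :=
        hev.mono fun z hz => by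
          have hz' : (fun w : E n => μ • w) =ᶠ[𝓝 z] id := hz
          simp [dsmul, hz'.fderiv_eq]
      exact isClosed_singleton.mem_of_frequently_of_tendsto this hc2
  exact fun y hy => (hsub hy).self_of_nhds

lemma eq_one_of_eventually {μ : c.Γ} {x : E n} (hx : x ∈ c.V) (h : ∀ᶠ z in 𝓝 x, μ • z = z) :
    μ = 1 := by
  refine eq_one_of_dsmul_eq_id hx h.self_of_nhds ?_
  have h' : (fun w : E n => μ • w) =ᶠ[𝓝 x] id := h
  simp [dsmul, h'.fderiv_eq]

lemma eventually_stab_le {x : E n} (hx : x ∈ c.V) : ∀ᶠ z in 𝓝 x, c.Stab z ≤ c.Stab x := by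
  have : ∀ μ : c.Γ, ∀ᶠ z in 𝓝 x, μ • z = z → μ • x = x := by
    intro μ
    by_cases h : μ • x = x
    · exact Eventually.of_forall fun _ _ => h
    · have : ContinuousAt (fun z : E n => μ • z - z) x := (continuousAt_smul μ hx).sub continuousAt_id
      filter_upwards [this.eventually_ne (sub_ne_zero.2 h)] with z hz hz'
      exact absurd (sub_eq_zero.2 hz') hz
  filter_upwards [eventually_all.2 this] with z hz μ hμ
  exact hz μ hμ

/-- Every nonempty open subset of a chart contains a point with trivial stabilizer. -/
lemma exists_stab_eq_bot {U : Set (E n)} (hU : IsOpen U) (hUV : U ⊆ c.V) (hne : U.Nonempty) :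
    ∃ y ∈ U, c.Stab y = ⊥ := by
  -- Stabilizers can only shrink nearby, so at a point of minimal stabilizer order they are locally
  -- constant. Each of their elements then fixes a neighbourhood and is trivial.
  obtain ⟨y, hy, hmin⟩ := (InvImage.wf (fun y : E n => Nat.card (c.Stab y))
    Nat.lt_wfRel.wf).has_min U hne
  refine ⟨y, hy, (Subgroup.eq_bot_iff_forall _).2 fun μ hμ => ?_⟩
  refine eq_one_of_eventually (hUV hy) ?_
  filter_upwards [eventually_stab_le (hUV hy), hU.mem_nhds hy] with z hz hzU
  have hcard : Nat.card (c.Stab y) ≤ Nat.card (c.Stab z) := not_lt.1 (hmin z hzU)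
  have : c.Stab z = c.Stab y := Subgroup.eq_of_le_of_card_ge hz hcard
  have hm : μ ∈ c.Stab z := this ▸ hμ
  exact hm

end OrbifoldChart

/-! ### Embeddings of charts: isotropy and uniqueness up to the target group. -/

namespace ChartEmbedding

open OrbifoldChart

variable {b c d : OrbifoldChart X n}

lemma contDiffAt (j : ChartEmbedding c d) {x : E n} (hx : x ∈ c.V) : ContDiffAt ℝ ∞ j.ψ x :=
  j.smooth.contDiffAt (c.isOpen_V.mem_nhds hx)

lemma hasStrictFDerivAt (j : ChartEmbedding c d) {x : E n} (hx : x ∈ c.V) :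
    HasStrictFDerivAt j.ψ (fderiv ℝ j.ψ x) x :=
  (j.contDiffAt hx).hasStrictFDerivAt (by simp)

lemma injOn (j : ChartEmbedding c d) : InjOn j.ψ c.V :=
  injOn_iff_injective.2 j.isEmbedding.injective

lemma surjective_fderiv (j : ChartEmbedding c d) {x : E n} (hx : x ∈ c.V) :
    Function.Surjective (fderiv ℝ j.ψ x) :=
  (LinearMap.injective_iff_surjective (f := (fderiv ℝ j.ψ x : E n →ₗ[ℝ] E n))).1
    (j.immersion x hx)

lemma map_nhds (j : ChartEmbedding c d) {x : E n} (hx : x ∈ c.V) :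
    Filter.map j.ψ (𝓝 x) = 𝓝 (j.ψ x) :=
  (j.hasStrictFDerivAt hx).map_nhds_eq_of_surj (LinearMap.range_eq_top.2 (j.surjective_fderiv hx))

/-- The identity embedding. -/
def refl (c : OrbifoldChart X n) : ChartEmbedding c c where
  ψ := id
  mapsTo := mapsTo_id _
  smooth := contDiffOn_id
  isEmbedding := IsEmbedding.subtypeVal
  immersion x _ := by simpa using Function.injective_id
  comp_eq _ _ := rfl
  θ := MonoidHom.id _
  injective_θ := Function.injective_id
  equivariant _ _ _ := rfl

/-- Composition of chart embeddings. -/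
def comp (j : ChartEmbedding c d) (k : ChartEmbedding b c) : ChartEmbedding b d where
  ψ := j.ψ ∘ k.ψ
  mapsTo := j.mapsTo.comp k.mapsTo
  smooth := j.smooth.comp k.smooth k.mapsTo
  isEmbedding := j.isEmbedding.comp (k.isEmbedding.codRestrict c.V fun x => k.mapsTo x.2)
  immersion x hx := by
    rw [((j.hasStrictFDerivAt (k.mapsTo hx)).hasFDerivAt.comp x
      (k.hasStrictFDerivAt hx).hasFDerivAt).fderiv]
    exact (j.immersion _ (k.mapsTo hx)).comp (k.immersion x hx)
  comp_eq x hx := (j.comp_eq _ (k.mapsTo hx)).trans (k.comp_eq x hx)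
  θ := j.θ.comp k.θ
  injective_θ := j.injective_θ.comp k.injective_θ
  equivariant μ x hx := by
    simp [k.equivariant μ x hx, j.equivariant _ _ (k.mapsTo hx)]

lemma isEmbedding_smul (ν : c.Γ) : IsEmbedding (c.V.domRestrict fun z : E n => ν • z) := by
  have hcont : ∀ κ : c.Γ, Continuous fun z : c.V => (⟨κ • (z : E n), c.smul_mem κ z z.2⟩ : c.V) :=
    fun κ => Continuous.subtype_mk
      (continuousOn_iff_continuous_domRestrict.1 (c.smooth_smul κ).continuousOn) _
  let h : c.V ≃ₜ c.V :=
    { toFun := fun z => ⟨ν • (z : E n), c.smul_mem ν z z.2⟩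
      invFun := fun z => ⟨ν⁻¹ • (z : E n), c.smul_mem ν⁻¹ z z.2⟩
      left_inv := fun z => by simp
      right_inv := fun z => by simp
      continuous_toFun := hcont ν
      continuous_invFun := hcont ν⁻¹ }
  exact IsEmbedding.subtypeVal.comp h.isEmbedding

/-- The action of an element of the group, as an embedding of the chart into itself. -/
def ofElement (ν : c.Γ) : ChartEmbedding c c where
  ψ := fun z => ν • z
  mapsTo := fun x hx => c.smul_mem ν x hx
  smooth := c.smooth_smul ν
  isEmbedding := isEmbedding_smul ν
  immersion x hx := by
    have h := dsmul_mul ν⁻¹ ν hx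
    rw [inv_mul_cancel, dsmul_one] at h
    intro v w hvw
    have h' := fun u => (DFunLike.congr_fun h u)
    have hv := h' v
    have hw := h' w
    simp only [ContinuousLinearMap.comp_apply, ContinuousLinearMap.id_apply] at hv hw
    rw [hv, hw]
    exact congrArg _ hvw
  comp_eq x hx := φ_smul ν hx
  θ := (MulAut.conj ν).toMonoidHom
  injective_θ := (MulAut.conj ν).injective
  equivariant μ x hx := by simp [mul_smul]

@[simp] lemma refl_ψ (x : E n) : (refl c).ψ x = x := rfl
@[simp] lemma refl_θ (μ : c.Γ) : (refl c).θ μ = μ := rfl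
@[simp] lemma comp_ψ (j : ChartEmbedding c d) (k : ChartEmbedding b c) (x : E n) :
    (j.comp k).ψ x = j.ψ (k.ψ x) := rfl
@[simp] lemma comp_θ (j : ChartEmbedding c d) (k : ChartEmbedding b c) (μ : b.Γ) :
    (j.comp k).θ μ = j.θ (k.θ μ) := rfl
@[simp] lemma ofElement_ψ (ν : c.Γ) (x : E n) : (ofElement ν).ψ x = ν • x := rfl
@[simp] lemma ofElement_θ (ν μ : c.Γ) : (ofElement ν).θ μ = ν * μ * ν⁻¹ := rfl

lemma θ_mem_stab (j : ChartEmbedding c d) {x : E n} (hx : x ∈ c.V) {μ : c.Γ} (hμ : μ ∈ c.Stab x) :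
    j.θ μ ∈ d.Stab (j.ψ x) := by
  have hμ' : μ • x = x := hμ
  change j.θ μ • j.ψ x = j.ψ x
  rw [← j.equivariant μ x hx, hμ']

/-- Every element of the stabilizer of an image point comes from the source. -/
lemma exists_θ_eq (j : ChartEmbedding c d) {x : E n} (hx : x ∈ c.V) {ν : d.Γ}
    (hν : ν ∈ d.Stab (j.ψ x)) : ∃ μ ∈ c.Stab x, j.θ μ = ν := by
  have hνx : ν • j.ψ x = j.ψ x := hν
  have hnear : ∀ᶠ w in 𝓝 (j.ψ x), w ∈ j.ψ '' c.V := by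
    rw [← j.map_nhds hx]
    exact image_mem_map (c.isOpen_V.mem_nhds hx)
  have hjV := j.mapsTo hx
  have hc : ContinuousAt (fun w : E n => ν • w) (j.ψ x) := continuousAt_smul ν hjV
  have hnear' : ∀ᶠ w in 𝓝 (j.ψ x), ν • w ∈ j.ψ '' c.V := by
    rw [ContinuousAt, hνx] at hc
    exact hc.eventually hnear
  obtain ⟨U, hUsub, hUo, hxU⟩ := mem_nhds_iff.1
    (hnear.and (hnear'.and (d.isOpen_V.mem_nhds hjV)))
  -- At a nearby free point `w` for which both `w` and `ν • w` lie in the image, their preimages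
  -- share an orbit of the source group. The element relating them maps to `ν`, with no ambiguity
  -- since `w` is free.
  obtain ⟨w, hwU, hw⟩ := d.exists_stab_eq_bot hUo (fun w hw => (hUsub hw).2.2) ⟨_, hxU⟩
  obtain ⟨⟨y, hy, hyw⟩, ⟨y', hy', hyw'⟩, hwV⟩ := hUsub hwU
  have hφ : c.φ y = c.φ y' := by
    rw [← j.comp_eq y hy, ← j.comp_eq y' hy', hyw, hyw', φ_smul ν hwV]
  obtain ⟨μ, hμ⟩ := (c.φ_eq_iff y hy y' hy').1 hφ
  have h1 : j.θ μ • w = ν • w := by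
    rw [← hyw, ← j.equivariant μ y hy, hμ, hyw', hyw]
  have h2 : ν⁻¹ * j.θ μ ∈ d.Stab w := by
    change (ν⁻¹ * j.θ μ) • w = w
    rw [mul_smul, h1, inv_smul_smul]
  rw [hw, Subgroup.mem_bot, inv_mul_eq_one] at h2
  refine ⟨μ, ?_, h2.symm⟩
  change μ • x = x
  refine j.injOn (c.smul_mem μ x hx) hx ?_
  rw [j.equivariant μ x hx, ← h2, hνx]

lemma stab_eq_bot_iff (j : ChartEmbedding c d) {x : E n} (hx : x ∈ c.V) :
    d.Stab (j.ψ x) = ⊥ ↔ c.Stab x = ⊥ := by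
  simp only [Subgroup.eq_bot_iff_forall]
  constructor
  · intro h μ hμ
    exact j.injective_θ ((h _ (j.θ_mem_stab hx hμ)).trans (map_one _).symm)
  · intro h ν hν
    obtain ⟨μ, hμ, rfl⟩ := j.exists_θ_eq hx hν
    rw [h μ hμ, map_one]

/-- Two embeddings of the same charts differ by an element of the target group. -/
lemma exists_eq_smul (j k : ChartEmbedding c d) :
    ∃ ν : d.Γ, (∀ x ∈ c.V, k.ψ x = ν • j.ψ x) ∧ ∀ μ, k.θ μ = ν * j.θ μ * ν⁻¹ := by
  suffices h : ∃ ν : d.Γ, ∀ x ∈ c.V, k.ψ x = ν • j.ψ x by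
    obtain ⟨ν, hν⟩ := h
    refine ⟨ν, hν, fun μ => ?_⟩
    obtain ⟨x₀, hx₀⟩ := c.isConnected_V.nonempty
    obtain ⟨x, hx, hbot⟩ := c.exists_stab_eq_bot c.isOpen_V subset_rfl ⟨x₀, hx₀⟩
    have hk : d.Stab (k.ψ x) = ⊥ := (k.stab_eq_bot_iff hx).2 hbot
    have h1 : k.θ μ • k.ψ x = (ν * j.θ μ * ν⁻¹) • k.ψ x := by
      rw [← k.equivariant μ x hx, hν _ (c.smul_mem μ x hx), j.equivariant μ x hx, hν x hx]
      simp [mul_smul]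
    have h2 : (k.θ μ)⁻¹ * (ν * j.θ μ * ν⁻¹) ∈ d.Stab (k.ψ x) := by
      change ((k.θ μ)⁻¹ * (ν * j.θ μ * ν⁻¹)) • k.ψ x = k.ψ x
      rw [mul_smul, ← h1, inv_smul_smul]
    rw [hk, Subgroup.mem_bot, inv_mul_eq_one] at h2
    exact h2
  -- Comparing 1-jets and not just values makes these sets disjoint, even at points with isotropy.
  -- They are closed and finite in number, and cover a dense set of free points, hence everything;
  -- connectedness leaves only one.
  let D : d.Γ → Set c.V := fun ν => {x | k.ψ x = ν • j.ψ x ∧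
    fderiv ℝ k.ψ x = (d.dsmul ν (j.ψ x)).comp (fderiv ℝ j.ψ x)}
  have hclosed : ∀ ν, IsClosed (D ν) := by
    intro ν
    have hj : Continuous fun x : c.V => j.ψ x :=
      continuousOn_iff_continuous_domRestrict.1 j.smooth.continuousOn
    have hk : Continuous fun x : c.V => k.ψ x :=
      continuousOn_iff_continuous_domRestrict.1 k.smooth.continuousOn
    have hdj : Continuous fun x : c.V => fderiv ℝ j.ψ x := continuousOn_iff_continuous_domRestrict.1
      (j.smooth.continuousOn_fderiv_of_isOpen c.isOpen_V (by simp))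
    have hdk : Continuous fun x : c.V => fderiv ℝ k.ψ x := continuousOn_iff_continuous_domRestrict.1
      (k.smooth.continuousOn_fderiv_of_isOpen c.isOpen_V (by simp))
    have hν : Continuous fun x : c.V => ν • j.ψ x :=
      continuousOn_iff_continuous_domRestrict.1
        ((d.smooth_smul ν).continuousOn.comp j.smooth.continuousOn j.mapsTo)
    have hdν : Continuous fun x : c.V => d.dsmul ν (j.ψ x) :=
      continuousOn_iff_continuous_domRestrict.1
        (((d.smooth_smul ν).continuousOn_fderiv_of_isOpen d.isOpen_V (by simp)).comp
          j.smooth.continuousOn j.mapsTo)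
    exact (isClosed_eq hk hν).inter (isClosed_eq hdk (hdν.clm_comp hdj))
  have hdisj : ∀ ν ν' : d.Γ, ∀ x, x ∈ D ν → x ∈ D ν' → ν = ν' := by
    rintro ν ν' ⟨x, hx⟩ ⟨h1, h2⟩ ⟨h1', h2'⟩
    have hjx := j.mapsTo hx
    have hfix : ν⁻¹ • ν' • j.ψ x = j.ψ x := by rw [← h1', h1, inv_smul_smul]
    have hfix' : (ν⁻¹ * ν') • j.ψ x = j.ψ x := by rw [mul_smul, hfix]
    have : ν⁻¹ * ν' = 1 := by
      refine eq_one_of_dsmul_eq_id hjx hfix' ?_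
      have hid := dsmul_mul ν⁻¹ ν hjx
      rw [inv_mul_cancel, dsmul_one] at hid
      ext1 v
      obtain ⟨u, rfl⟩ := j.surjective_fderiv hx v
      have e1 := DFunLike.congr_fun h2 u
      have e2 := DFunLike.congr_fun h2' u
      have e3 := DFunLike.congr_fun hid (fderiv ℝ j.ψ x u)
      simp only [ContinuousLinearMap.comp_apply, ContinuousLinearMap.id_apply] at e1 e2 e3
      rw [dsmul_mul _ _ hjx, ContinuousLinearMap.comp_apply, ← e2, e1, ← h1', h1,
        ContinuousLinearMap.id_apply]
      exact e3.symm
    exact inv_mul_eq_one.1 this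
  have hcover : ∀ x : c.V, ∃ ν, x ∈ D ν := by
    have hcl : IsClosed (⋃ ν, D ν) := isClosed_iUnion_of_finite hclosed
    suffices h : Dense (⋃ ν, D ν) from fun x => by
      have := h x
      rw [hcl.closure_eq] at this
      exact mem_iUnion.1 this
    intro x
    rw [mem_closure_iff]
    intro o ho hxo
    obtain ⟨y, hy, hbot⟩ := c.exists_stab_eq_bot (c.isOpen_V.isOpenMap_subtype_val o ho)
      (by rintro _ ⟨z, -, rfl⟩; exact z.2) ⟨x, x, hxo, rfl⟩
    obtain ⟨⟨y, hyV⟩, hyo, rfl⟩ := hy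
    have hlam : ∀ z ∈ c.V, ∃ ν : d.Γ, ν • j.ψ z = k.ψ z := fun z hz =>
      (d.φ_eq_iff _ (j.mapsTo hz) _ (k.mapsTo hz)).1 (by rw [j.comp_eq z hz, k.comp_eq z hz])
    obtain ⟨ν, hν⟩ := hlam y hyV
    have hev : ∀ᶠ z in 𝓝 y, k.ψ z = ν • j.ψ z := by
      have : ∀ κ : d.Γ, ∀ᶠ z in 𝓝 y, κ • j.ψ z = k.ψ z → κ = ν := by
        intro κ
        by_cases h : κ • j.ψ y = k.ψ y
        · have : ν⁻¹ * κ ∈ d.Stab (j.ψ y) := by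
            change (ν⁻¹ * κ) • j.ψ y = j.ψ y
            rw [mul_smul, h, ← hν, inv_smul_smul]
          rw [(j.stab_eq_bot_iff hyV).2 hbot, Subgroup.mem_bot, inv_mul_eq_one] at this
          exact Eventually.of_forall fun _ _ => this.symm
        · have hc : ContinuousAt (fun z : E n => κ • j.ψ z - k.ψ z) y := by
            refine ContinuousAt.sub ?_ (k.contDiffAt hyV).continuousAt
            exact ContinuousAt.comp' (f := j.ψ) (g := fun w : E n => κ • w)
              (continuousAt_smul κ (j.mapsTo hyV)) (j.contDiffAt hyV).continuousAt
          filter_upwards [hc.eventually_ne (sub_ne_zero.2 h)] with z hz hz'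
          exact absurd (sub_eq_zero.2 hz') hz
      filter_upwards [eventually_all.2 this, c.isOpen_V.mem_nhds hyV] with z hz hzV
      obtain ⟨κ, hκ⟩ := hlam z hzV
      rw [← hz κ hκ, hκ]
    refine ⟨⟨y, hyV⟩, hyo, mem_iUnion.2 ⟨ν, hν.symm, ?_⟩⟩
    have hev' : k.ψ =ᶠ[𝓝 y] fun z => ν • j.ψ z := hev
    rw [hev'.fderiv_eq]
    exact ((hasStrictFDerivAt_smul ν (j.mapsTo hyV)).hasFDerivAt.comp y
      (j.hasStrictFDerivAt hyV).hasFDerivAt).fderiv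
  obtain ⟨x₀, hx₀⟩ := c.isConnected_V.nonempty
  obtain ⟨ν, hν⟩ := hcover ⟨x₀, hx₀⟩
  have hopen : IsOpen (D ν) := by
    have : D ν = (⋃ κ : {κ : d.Γ // κ ≠ ν}, D κ)ᶜ := by
      ext x
      simp only [mem_compl_iff, mem_iUnion, not_exists]
      constructor
      · intro h κ hκ
        exact κ.2 (hdisj _ _ x hκ h)
      · intro h
        obtain ⟨κ, hκ⟩ := hcover x
        by_cases e : κ = ν
        · exact e ▸ hκ
        · exact absurd hκ (h ⟨κ, e⟩)
    rw [this]
    exact (isClosed_iUnion_of_finite fun κ : {κ : d.Γ // κ ≠ ν} => hclosed κ).isOpen_compl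
  have : PreconnectedSpace c.V := Subtype.preconnectedSpace c.isConnected_V.isPreconnected
  have huniv : D ν = univ := IsClopen.eq_univ ⟨hclosed ν, hopen⟩ ⟨_, hν⟩
  refine ⟨ν, fun x hx => ?_⟩
  have : (⟨x, hx⟩ : c.V) ∈ D ν := huniv ▸ mem_univ _
  exact this.1

end ChartEmbedding

/-! ### Common refinements of charts and of embeddings. -/

namespace EffectiveOrbifold

open OrbifoldChart ChartEmbedding

/-- Two charts that meet at a point have a common refinement there, with prescribed lifts. -/
lemma exists_refinement (O : EffectiveOrbifold X n) {c d : OrbifoldChart X n} (hc : c ∈ O.charts)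
    (hd : d ∈ O.charts) {x y : E n} (hx : x ∈ c.V) (hy : y ∈ d.V) (hxy : c.φ x = d.φ y) :
    ∃ e ∈ O.charts, ∃ (j : ChartEmbedding e c) (k : ChartEmbedding e d), ∃ z ∈ e.V,
      j.ψ z = x ∧ k.ψ z = y := by
  obtain ⟨e, he, ⟨z, hz, hzx⟩, ⟨j⟩, ⟨k⟩⟩ := O.compatible c hc d hd (c.φ x)
    ⟨⟨x, hx, rfl⟩, ⟨y, hy, hxy.symm⟩⟩
  obtain ⟨μ, hμ⟩ := (c.φ_eq_iff _ (j.mapsTo hz) x hx).1 (by rw [j.comp_eq z hz, hzx])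
  obtain ⟨ν, hν⟩ := (d.φ_eq_iff _ (k.mapsTo hz) y hy).1 (by rw [k.comp_eq z hz, hzx, hxy])
  exact ⟨e, he, (ofElement μ).comp j, (ofElement ν).comp k, z, hz, hμ, hν⟩

/-- Two embeddings with a common value have a common refinement on which they agree. -/
lemma exists_pullback (O : EffectiveOrbifold X n) {b c d : OrbifoldChart X n} (hc : c ∈ O.charts)
    (hd : d ∈ O.charts) (j : ChartEmbedding c b) (k : ChartEmbedding d b)
    {x y : E n} (hx : x ∈ c.V) (hy : y ∈ d.V) (hxy : j.ψ x = k.ψ y) :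
    ∃ e ∈ O.charts, ∃ (l : ChartEmbedding e c) (m : ChartEmbedding e d), ∃ z ∈ e.V,
      l.ψ z = x ∧ m.ψ z = y ∧ ∀ μ, j.θ (l.θ μ) = k.θ (m.θ μ) := by
  obtain ⟨e, he, l, m, z, hz, hlz, hmz⟩ := O.exists_refinement hc hd hx hy
    (by rw [← j.comp_eq x hx, ← k.comp_eq y hy, hxy])
  -- The discrepancy `ν` between the two composites fixes the common value, so it comes from some
  -- `κ` in the stabilizer of `x`. Replacing `l` by `κ ∘ l` absorbs it.
  obtain ⟨ν, hν, hθ⟩ := (j.comp l).exists_eq_smul (k.comp m)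
  have hνz : ν ∈ b.Stab (j.ψ x) := by
    have := hν z hz
    rw [comp_ψ, comp_ψ, hlz, hmz, ← hxy] at this
    exact this.symm
  obtain ⟨κ, hκ, rfl⟩ := j.exists_θ_eq hx hνz
  have hκx : κ • x = x := hκ
  refine ⟨e, he, (ofElement κ).comp l, m, z, hz, by simp [hlz, hκx], hmz, fun μ => ?_⟩
  have := hθ μ
  simp only [comp_θ, ofElement_θ, map_mul, map_inv] at this ⊢
  exact this.symm

end EffectiveOrbifold

end OrbifoldMorse

/-! ### Lifting flow lines to charts: existence, uniqueness and limits. -/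

namespace OrbifoldMorse

/-- An additive relation on pairs of reals that holds on short intervals holds on long ones. -/
lemma Icc_chain_induction {P : ℝ → ℝ → Prop} {a b : ℝ} (hab : a ≤ b)
    (hloc : ∀ r ∈ Icc a b, ∃ ε > 0, ∀ s t, a ≤ s → s ≤ t → t ≤ b →
      s ∈ Ioo (r - ε) (r + ε) → t ∈ Ioo (r - ε) (r + ε) → P s t)
    (htrans : ∀ s t u, a ≤ s → s ≤ t → t ≤ u → u ≤ b → P s t → P t u → P s u) : P a b := by
  choose ε hε hP using fun r : Icc a b => hloc r r.2
  obtain ⟨t, ht0, hmono, ⟨m, hm⟩, hsub⟩ := exists_monotone_Icc_subset_open_cover_Icc hab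
    (c := fun r : Icc a b => Subtype.val ⁻¹' Ioo ((r : ℝ) - ε r) (r + ε r))
    (fun r => isOpen_Ioo.preimage continuous_subtype_val)
    (fun r _ => mem_iUnion.2 ⟨r, by simp [hε r]⟩)
  have key : ∀ k, P a (t (k + 1)) := by
    have step : ∀ k, P (t k) (t (k + 1)) := by
      intro k
      obtain ⟨r, hr⟩ := hsub k
      exact hP r _ _ (t k).2.1 (hmono k.le_succ) (t (k + 1)).2.2
        (hr (left_mem_Icc.2 (hmono k.le_succ))) (hr (right_mem_Icc.2 (hmono k.le_succ)))
    intro k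
    induction k with
    | zero => simpa [ht0] using step 0
    | succ k ih =>
      exact htrans _ _ _ le_rfl (t (k + 1)).2.1 (hmono (Nat.le_succ _)) (t (k + 2)).2.2 ih
        (step (k + 1))
  simpa [hm (m + 1) (Nat.le_succ m)] using key m

variable {X : Type*} [TopologicalSpace X] {n : ℕ}

lemma OrbifoldChart.image_mem_nhds {c : OrbifoldChart X n} {x : E n} (hx : x ∈ c.V) {W : Set (E n)}
    (hW : W ∈ 𝓝 x) : c.φ '' (W ∩ c.V) ∈ 𝓝 (c.φ x) := by
  have h := c.isOpenMap_φ.image_mem_nhds (x := ⟨x, hx⟩)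
    (preimage_coe_mem_nhds_subtype.2 (mem_nhdsWithin_of_mem_nhds hW))
  rwa [image_domRestrict] at h

lemma OrbifoldChart.range_mem_nhds {c : OrbifoldChart X n} {u : X} (hu : u ∈ c.range) :
    c.range ∈ 𝓝 u := by
  obtain ⟨x, hx, rfl⟩ := hu
  simpa [OrbifoldChart.range] using c.image_mem_nhds hx univ_mem

namespace EffectiveOrbifold

open OrbifoldChart ChartEmbedding

variable {c d : OrbifoldChart X n} {γ : ℝ → X} {I J : Set ℝ} {β : ℝ → E n}

lemma IsLift.mono (h : IsLift c γ I β) (hJ : J ⊆ I) : IsLift c γ J β :=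
  ⟨h.1.mono hJ, fun s hs => h.2 s (hJ hs)⟩

lemma IsLift.congr {β' : ℝ → E n} (h : IsLift c γ I β) (he : EqOn β' β I) : IsLift c γ I β' :=
  ⟨h.1.congr he, fun s hs => by rw [he hs]; exact h.2 s hs⟩

lemma IsLift.mapsTo (h : IsLift c γ I β) : MapsTo β I c.V := fun s hs => (h.2 s hs).1

lemma IsLift.embed (h : IsLift c γ I β) (j : ChartEmbedding c d) :
    IsLift d γ I (fun s => j.ψ (β s)) :=
  ⟨j.smooth.continuousOn.comp h.1 h.mapsTo, fun s hs =>
    ⟨j.mapsTo (h.mapsTo hs), (j.comp_eq _ (h.mapsTo hs)).trans (h.2 s hs).2⟩⟩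

lemma IsLift.smul (h : IsLift c γ I β) (μ : c.Γ) : IsLift c γ I (fun s => μ • β s) :=
  h.embed (ofElement μ)

lemma IsLift.exists_smul_eq {β' : ℝ → E n} (h : IsLift c γ I β) (h' : IsLift c γ J β') {r : ℝ}
    (hr : r ∈ I) (hr' : r ∈ J) : ∃ μ : c.Γ, μ • β r = β' r :=
  (c.φ_eq_iff _ (h.mapsTo hr) _ (h'.mapsTo hr')).1 ((h.2 r hr).2.trans (h'.2 r hr').2.symm)

/-- At the common time `b` the two values lie in one orbit, so a group element moves the second lift
to continue the first. -/
lemma IsLift.glue {β' : ℝ → E n} {a b b' : ℝ} (hab : a ≤ b) (hbb' : b ≤ b')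
    (h : IsLift c γ (Icc a b) β) (h' : IsLift c γ (Icc b b') β') :
    ∃ δ, IsLift c γ (Icc a b') δ := by
  obtain ⟨μ, hμ⟩ := h'.exists_smul_eq h (left_mem_Icc.2 hbb') (right_mem_Icc.2 hab)
  let δ : ℝ → E n := fun r => if r ≤ b then β r else μ • β' r
  have h1 : IsLift c γ (Icc a b) δ := h.congr fun r hr => by simp [δ, hr.2]
  have h2 : IsLift c γ (Icc b b') δ := (h'.smul μ).congr fun r hr => by
    by_cases e : r ≤ b
    · obtain rfl : r = b := le_antisymm e hr.1
      simp [δ, hμ]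
    · simp [δ, e]
  refine ⟨δ, ?_, fun s hs => ?_⟩
  · rw [← Icc_union_Icc_eq_Icc hab hbb']
    exact h1.1.union_of_isClosed h2.1 isClosed_Icc isClosed_Icc
  · rcases le_total s b with e | e
    · exact h1.2 s ⟨hs.1, e⟩
    · exact h2.2 s ⟨e, hs.2⟩

section Field

variable {O : EffectiveOrbifold X n}

lemma IsInnerProduct.isInvertible {a : E n →L[ℝ] E n →L[ℝ] ℝ} (ha : IsInnerProduct a) :
    a.IsInvertible := by
  have hinj : Function.Injective (a : E n →ₗ[ℝ] E n →L[ℝ] ℝ) := by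
    rw [injective_iff_map_eq_zero]
    intro v hv
    by_contra hne
    have := ha.2 v hne
    rw [show a v = 0 from hv] at this
    simp at this
  have hdim : Module.finrank ℝ (E n) = Module.finrank ℝ (E n →L[ℝ] ℝ) := by
    rw [← (LinearMap.toContinuousLinearMap (𝕜 := ℝ) (E := E n) (F' := ℝ)).finrank_eq]
    exact (Subspace.dual_finrank_eq (K := ℝ) (V := E n)).symm
  refine ⟨(LinearEquiv.ofInjectiveOfFinrankEq _ hinj hdim).toContinuousLinearEquiv, ?_⟩
  ext v w
  rfl

/-- The negative gradient of the local representative of `f`. -/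
noncomputable def negGrad (g : O.RiemannianMetric) (f : X → ℝ) (c : OrbifoldChart X n) (x : E n) :
    E n :=
  (g.inner c x).inverse (-(fderiv ℝ (rep c f) x))

variable {g : O.RiemannianMetric} {f : X → ℝ}

lemma inner_negGrad (hc : c ∈ O.charts) {x : E n} (hx : x ∈ c.V) :
    g.inner c x (negGrad g f c x) = -(fderiv ℝ (rep c f) x) :=
  (g.isInnerProduct c hc x hx).isInvertible.self_apply_inverse _

lemma IsNegGrad.eq_negGrad (hc : c ∈ O.charts) {x v : E n} (hx : x ∈ c.V)
    (h : IsNegGrad g f c x v) : v = negGrad g f c x := by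
  have : g.inner c x v = -(fderiv ℝ (rep c f) x) := by
    ext w
    simpa using h w
  rw [negGrad, ← this, (g.isInnerProduct c hc x hx).isInvertible.inverse_apply_self]

/-- One derivative is lost from `f` and none from the metric. The resulting `C¹` regularity supplies
both ODE uniqueness and the linearization at critical points. -/
lemma contDiffAt_negGrad (hf : O.IsMorse f) (hc : c ∈ O.charts) {x : E n} (hx : x ∈ c.V) :
    ContDiffAt ℝ 1 (negGrad g f c) x := by
  have h1 : ContDiffAt ℝ 1 (fderiv ℝ (rep c f)) x :=
    ((hf c hc).1.contDiffAt (c.isOpen_V.mem_nhds hx)).fderiv_right (by norm_num)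
  have h2 : ContDiffAt ℝ 1 (g.inner c) x :=
    (g.contDiffOn c hc).contDiffAt (c.isOpen_V.mem_nhds hx)
  have h3 : ContDiffAt ℝ 1 (fun y => (g.inner c y).inverse) x :=
    ((g.isInnerProduct c hc x hx).isInvertible.contDiffAt_map_inverse).comp x h2
  exact h3.clm_apply h1.neg

end Field

section Flow

variable {O : EffectiveOrbifold X n} {g : O.RiemannianMetric} {f : X → ℝ} {p q : X}

lemma IsFlowLine.hasDerivAt (hγ : IsFlowLine g f p q γ) (hc : c ∈ O.charts)
    (hβ : IsLift c γ I β) {t : ℝ} (ht : I ∈ 𝓝 t) : HasDerivAt β (negGrad g f c (β t)) t := by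
  have ht' := mem_interior_iff_mem_nhds.2 ht
  obtain ⟨v, hv, hneg⟩ := hγ.flow c hc (interior I) isOpen_interior β (hβ.mono interior_subset) t ht'
  rwa [← hneg.eq_negGrad hc (hβ.mapsTo (interior_subset ht'))]

/-- The flow equation is only assumed for lifts over open sets of times. At the endpoint of a closed
interval the one-sided derivative is recovered as the limit of the interior derivatives. -/
lemma IsFlowLine.hasDerivWithinAt_Ici (hγ : IsFlowLine g f p q γ) (hf : O.IsMorse f)
    (hc : c ∈ O.charts) {a b : ℝ} (hβ : IsLift c γ (Icc a b) β) {t : ℝ} (ht : t ∈ Ico a b) :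
    HasDerivWithinAt β (negGrad g f c (β t)) (Ici t) t := by
  have hd : ∀ s ∈ Ioo t b, HasDerivAt β (negGrad g f c (β s)) s := fun s hs =>
    hγ.hasDerivAt hc hβ (Icc_mem_nhds (ht.1.trans_lt hs.1) hs.2)
  have hsub : Ioo t b ⊆ Icc a b := fun s hs => ⟨ht.1.trans hs.1.le, hs.2.le⟩
  have hcont : ContinuousWithinAt β (Ioo t b) t := (hβ.1 t ⟨ht.1, ht.2.le⟩).mono hsub
  refine hasDerivWithinAt_Ici_of_tendsto_deriv
    (fun s hs => (hd s hs).differentiableAt.differentiableWithinAt) hcont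
    (Ioo_mem_nhdsGT ht.2) ?_
  have h1 : Tendsto (fun s => negGrad g f c (β s)) (𝓝[>] t) (𝓝 (negGrad g f c (β t))) := by
    rw [← nhdsWithin_Ioo_eq_nhdsGT ht.2]
    exact (contDiffAt_negGrad hf hc (hβ.mapsTo ⟨ht.1, ht.2.le⟩)).continuousAt.tendsto.comp hcont
  exact h1.congr' (by filter_upwards [Ioo_mem_nhdsGT ht.2] with s hs using (hd s hs).deriv.symm)

lemma IsFlowLine.hasDerivWithinAt_Iic (hγ : IsFlowLine g f p q γ) (hf : O.IsMorse f)
    (hc : c ∈ O.charts) {a b : ℝ} (hβ : IsLift c γ (Icc a b) β) {t : ℝ} (ht : t ∈ Ioc a b) :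
    HasDerivWithinAt β (negGrad g f c (β t)) (Iic t) t := by
  have hd : ∀ s ∈ Ioo a t, HasDerivAt β (negGrad g f c (β s)) s := fun s hs =>
    hγ.hasDerivAt hc hβ (Icc_mem_nhds hs.1 (hs.2.trans_le ht.2))
  have hsub : Ioo a t ⊆ Icc a b := fun s hs => ⟨hs.1.le, hs.2.le.trans ht.2⟩
  have hcont : ContinuousWithinAt β (Ioo a t) t := (hβ.1 t ⟨ht.1.le, ht.2⟩).mono hsub
  refine hasDerivWithinAt_Iic_of_tendsto_deriv
    (fun s hs => (hd s hs).differentiableAt.differentiableWithinAt) hcont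
    (Ioo_mem_nhdsLT ht.1) ?_
  have h1 : Tendsto (fun s => negGrad g f c (β s)) (𝓝[<] t) (𝓝 (negGrad g f c (β t))) := by
    rw [← nhdsWithin_Ioo_eq_nhdsLT ht.1]
    exact (contDiffAt_negGrad hf hc (hβ.mapsTo ⟨ht.1.le, ht.2⟩)).continuousAt.tendsto.comp hcont
  exact h1.congr' (by filter_upwards [Ioo_mem_nhdsLT ht.1] with s hs using (hd s hs).deriv.symm)

/-- Lifts of a flow line to a chart are determined by their value at one time. -/
lemma IsFlowLine.eqOn_Icc (hγ : IsFlowLine g f p q γ) (hf : O.IsMorse f) (hc : c ∈ O.charts)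
    {a b r : ℝ} {β' : ℝ → E n} (hβ : IsLift c γ (Icc a b) β) (hβ' : IsLift c γ (Icc a b) β')
    (hr : r ∈ Icc a b) (h : β r = β' r) : EqOn β β' (Icc a b) := by
  obtain ⟨K, hK⟩ : ∃ K, LipschitzOnWith K (negGrad g f c) (β '' Icc a b ∪ β' '' Icc a b) := by
    refine LocallyLipschitzOn.exists_lipschitzOnWith_of_compact
      ((isCompact_Icc.image_of_continuousOn hβ.1).union
        (isCompact_Icc.image_of_continuousOn hβ'.1)) fun x hx => ?_
    have hxV : x ∈ c.V := by
      rcases hx with ⟨s, hs, rfl⟩ | ⟨s, hs, rfl⟩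
      · exact hβ.mapsTo hs
      · exact hβ'.mapsTo hs
    obtain ⟨K, t, ht, hK⟩ := (contDiffAt_negGrad (g := g) hf hc hxV).exists_lipschitzOnWith
    exact ⟨K, t, mem_nhdsWithin_of_mem_nhds ht, hK⟩
  have hsubr : Icc r b ⊆ Icc a b := Icc_subset_Icc_left hr.1
  have hsubl : Icc a r ⊆ Icc a b := Icc_subset_Icc_right hr.2
  have hright : EqOn β β' (Icc r b) :=
    ODE_solution_unique_of_mem_Icc_right (v := fun _ => negGrad g f c) (K := K)
      (s := fun _ => β '' Icc a b ∪ β' '' Icc a b)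
      (fun _ _ => hK) (hβ.1.mono hsubr) (fun t ht => hγ.hasDerivWithinAt_Ici hf hc (hβ.mono hsubr) ht)
      (fun t ht => Or.inl ⟨t, hsubr (Ico_subset_Icc_self ht), rfl⟩) (hβ'.1.mono hsubr)
      (fun t ht => hγ.hasDerivWithinAt_Ici hf hc (hβ'.mono hsubr) ht)
      (fun t ht => Or.inr ⟨t, hsubr (Ico_subset_Icc_self ht), rfl⟩) h
  have hleft : EqOn β β' (Icc a r) :=
    ODE_solution_unique_of_mem_Icc_left (v := fun _ => negGrad g f c) (K := K)
      (s := fun _ => β '' Icc a b ∪ β' '' Icc a b)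
      (fun _ _ => hK) (hβ.1.mono hsubl) (fun t ht => hγ.hasDerivWithinAt_Iic hf hc (hβ.mono hsubl) ht)
      (fun t ht => Or.inl ⟨t, hsubl (Ioc_subset_Icc_self ht), rfl⟩) (hβ'.1.mono hsubl)
      (fun t ht => hγ.hasDerivWithinAt_Iic hf hc (hβ'.mono hsubl) ht)
      (fun t ht => Or.inr ⟨t, hsubl (Ioc_subset_Icc_self ht), rfl⟩) h
  intro t ht
  rcases le_total t r with e | e
  · exact hleft ⟨ht.1, e⟩
  · exact hright ⟨e, ht.2⟩

lemma IsFlowLine.eqOn_of_ordConnected (hγ : IsFlowLine g f p q γ) (hf : O.IsMorse f)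
    (hc : c ∈ O.charts) (hI : I.OrdConnected) {r : ℝ} {β' : ℝ → E n} (hβ : IsLift c γ I β)
    (hβ' : IsLift c γ I β') (hr : r ∈ I) (h : β r = β' r) : EqOn β β' I := by
  intro t ht
  have hsub : Icc (min r t) (max r t) ⊆ I := hI.uIcc_subset hr ht
  exact hγ.eqOn_Icc hf hc (hβ.mono hsub) (hβ'.mono hsub) ⟨min_le_left _ _, le_max_left _ _⟩ h
    ⟨min_le_right _ _, le_max_right _ _⟩

/-- If `μ` fixes the lift `β` at one time, then `μβ` and `β` are lifts agreeing there, so they agree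
throughout. -/
lemma IsFlowLine.stab_eq (hγ : IsFlowLine g f p q γ) (hf : O.IsMorse f)
    (hc : c ∈ O.charts) (hI : I.OrdConnected) (hβ : IsLift c γ I β) {r t : ℝ} (hr : r ∈ I)
    (ht : t ∈ I) : c.Stab (β r) = c.Stab (β t) := by
  have key : ∀ r ∈ I, ∀ t ∈ I, c.Stab (β r) ≤ c.Stab (β t) := fun r hr t ht μ hμ =>
    hγ.eqOn_of_ordConnected hf hc hI (hβ.smul μ) hβ hr hμ ht
  exact le_antisymm (key r hr t ht) (key t ht r hr)

lemma IsFlowLine.exists_lift_through (hγ : IsFlowLine g f p q γ) (hc : c ∈ O.charts) {r : ℝ}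
    {z : E n} (hz : z ∈ c.V) (hzr : c.φ z = γ r) :
    ∃ ε > 0, ∃ β, IsLift c γ (Ioo (r - ε) (r + ε)) β ∧ β r = z := by
  obtain ⟨ε, hε, β, hβ⟩ := hγ.exists_lift c hc r ⟨z, hz, hzr⟩
  have hr : r ∈ Ioo (r - ε) (r + ε) := by simp [hε]
  obtain ⟨μ, hμ⟩ := (c.φ_eq_iff _ (hβ.mapsTo hr) z hz).1 ((hβ.2 r hr).2.trans hzr.symm)
  exact ⟨ε, hε, _, hβ.smul μ, hμ⟩

lemma IsFlowLine.exists_lift_Icc (hγ : IsFlowLine g f p q γ) (hc : c ∈ O.charts) {a b : ℝ}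
    (hab : a ≤ b) (h : ∀ r ∈ Icc a b, γ r ∈ c.range) : ∃ β, IsLift c γ (Icc a b) β := by
  refine Icc_chain_induction (P := fun s t => ∃ β, IsLift c γ (Icc s t) β) hab ?_ ?_
  · intro r hr
    obtain ⟨ε, hε, β, hβ⟩ := hγ.exists_lift c hc r (h r hr)
    exact ⟨ε, hε, fun s t _ _ _ hs ht => ⟨β, hβ.mono (Icc_subset_Ioo hs.1 ht.2)⟩⟩
  · rintro s t u - hst htu - ⟨β, hβ⟩ ⟨β', hβ'⟩
    exact hβ.glue hst htu hβ'

lemma IsFlowLine.exists_lift_of_isOpen (hγ : IsFlowLine g f p q γ) (hf : O.IsMorse f)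
    (hc : c ∈ O.charts) (hI : I.OrdConnected) (hIo : IsOpen I) (h : ∀ r ∈ I, γ r ∈ c.range) :
    ∃ β, IsLift c γ I β := by
  rcases I.eq_empty_or_nonempty with rfl | ⟨r, hr⟩
  · exact ⟨0, continuousOn_empty _, by simp⟩
  obtain ⟨z, hz, hzr⟩ := h r hr
  have hthrough : ∀ a b, r ∈ Icc a b → Icc a b ⊆ I →
      ∃ β, IsLift c γ (Icc a b) β ∧ β r = z := by
    intro a b hrab hsub
    obtain ⟨β, hβ⟩ := hγ.exists_lift_Icc hc (hrab.1.trans hrab.2) fun s hs => h s (hsub hs)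
    obtain ⟨μ, hμ⟩ := (c.φ_eq_iff _ (hβ.mapsTo hrab) z hz).1 ((hβ.2 r hrab).2.trans hzr.symm)
    exact ⟨_, hβ.smul μ, hμ⟩
  choose! L hL hLr using fun u (hu : u ∈ I) => hthrough (min r u) (max r u)
    ⟨min_le_left _ _, le_max_left _ _⟩ (hI.uIcc_subset hr hu)
  have key : ∀ u ∈ I, ∃ β : ℝ → E n, (∀ᶠ w in 𝓝 u, L w w = β w) ∧ ContinuousAt β u ∧
      β u ∈ c.V ∧ c.φ (β u) = γ u := by
    intro u hu
    obtain ⟨a', b', hu', hsub'⟩ := mem_nhds_iff_exists_Ioo_subset.1 (hIo.mem_nhds hu)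
    obtain ⟨a, ha1, ha2⟩ := exists_between hu'.1
    obtain ⟨b, hb1, hb2⟩ := exists_between hu'.2
    have haI : a ∈ I := hsub' ⟨ha1, ha2.trans hu'.2⟩
    have hbI : b ∈ I := hsub' ⟨hu'.1.trans hb1, hb2⟩
    have hA : min r a ∈ I := by rcases min_choice r a with e | e <;> rw [e] <;> assumption
    have hB : max r b ∈ I := by rcases max_choice r b with e | e <;> rw [e] <;> assumption
    have hsub : Icc (min r a) (max r b) ⊆ I := hI.out hA hB
    obtain ⟨β, hβ, hβr⟩ := hthrough _ _ ⟨min_le_left r a, le_max_left r b⟩ hsub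
    have hnhds : Icc (min r a) (max r b) ∈ 𝓝 u :=
      Icc_mem_nhds ((min_le_right _ _).trans_lt ha2) (hb1.trans_le (le_max_right _ _))
    have hu'' := mem_of_mem_nhds hnhds
    refine ⟨β, ?_, hβ.1.continuousAt hnhds, hβ.2 u hu''⟩
    filter_upwards [hnhds] with w hw
    have hsubw : Icc (min r w) (max r w) ⊆ Icc (min r a) (max r b) :=
      (ordConnected_Icc (a := min r a) (b := max r b)).uIcc_subset
        ⟨min_le_left r a, le_max_left r b⟩ hw
    exact hγ.eqOn_Icc hf hc (hL w (hsub hw)) (hβ.mono hsubw)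
      ⟨min_le_left _ _, le_max_left _ _⟩ ((hLr w (hsub hw)).trans hβr.symm)
      ⟨min_le_right _ _, le_max_right _ _⟩
  -- `L w` is the lift over the interval from `r` to `w` normalized at `r`. By uniqueness the
  -- diagonal agrees near each `u` with a single lift, so it is continuous.
  refine ⟨fun w => L w w, fun u hu => ?_, fun u hu => ?_⟩
  · obtain ⟨β, h1, h2, -⟩ := key u hu
    exact (h2.congr (h1.mono fun _ => Eq.symm)).continuousWithinAt
  · obtain ⟨β, h1, -, h3⟩ := key u hu
    have e : L u u = β u := h1.self_of_nhds
    simpa only [e] using h3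

/-- The orbit of `x` is finite, so it has disjoint neighbourhoods. A lift of a path tending to `φ x`
eventually lies in their union, and a connected tail must stay in one of them. -/
lemma IsLift.exists_tendsto {l : Filter ℝ} [l.NeBot]
    (hl : ∀ s ∈ l, ∃ t ∈ l, t ⊆ s ∧ IsPreconnected t) (hβ : IsLift c γ I β) (hI : I ∈ l)
    {x : E n} (hx : x ∈ c.V) (hγ : Tendsto γ l (𝓝 (c.φ x))) :
    ∃ μ : c.Γ, Tendsto β l (𝓝 (μ • x)) := by
  obtain ⟨U, hU, hdisj⟩ := (Set.finite_range fun μ : c.Γ => μ • x).t2_separation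
  have hnear : ∀ N : c.Γ → Set (E n), (∀ μ, N μ ∈ 𝓝 (μ • x)) →
      ∀ᶠ t in l, ∃ μ : c.Γ, β t ∈ N μ := by
    intro N hN
    have hW : (⋂ μ : c.Γ, (fun z : E n => μ • z) ⁻¹' N μ) ∈ 𝓝 x :=
      iInter_mem.2 fun μ => continuousAt_smul μ hx (hN μ)
    filter_upwards [hI, hγ (c.image_mem_nhds hx hW)] with t ht htW
    obtain ⟨z, ⟨hzW, hzV⟩, hz⟩ := htW
    obtain ⟨μ, hμ⟩ := (c.φ_eq_iff z hzV _ (hβ.mapsTo ht)).1 (hz.trans (hβ.2 t ht).2.symm)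
    exact ⟨μ, hμ ▸ mem_iInter.1 hzW μ⟩
  obtain ⟨T, hTl, hTsub, hT⟩ := hl _ (inter_mem hI
    (hnear (fun μ => U (μ • x)) fun μ => (hU _).2.mem_nhds (hU _).1))
  obtain ⟨t₀, ht₀⟩ := Filter.nonempty_of_mem hTl
  obtain ⟨μ, hμ⟩ := (hTsub ht₀).2
  have hall : ∀ t ∈ T, β t ∈ U (μ • x) := by
    have himg : IsPreconnected (β '' T) := hT.image β (hβ.1.mono fun t ht => (hTsub ht).1)
    let W : Set (E n) := ⋃ y ∈ {y ∈ range (fun κ : c.Γ => κ • x) | y ≠ μ • x}, U y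
    have hsub : β '' T ⊆ U (μ • x) := by
      refine himg.subset_left_of_subset_union (v := W) (hU _).2
        (isOpen_biUnion fun y _ => (hU y).2) ?_ ?_ ⟨β t₀, mem_image_of_mem β ht₀, hμ⟩
      · refine disjoint_iUnion₂_right.2 fun y hy => ?_
        exact hdisj ⟨μ, rfl⟩ hy.1 hy.2.symm
      · rintro _ ⟨t, ht, rfl⟩
        obtain ⟨κ, hκ⟩ := (hTsub ht).2
        by_cases e : κ • x = μ • x
        · exact Or.inl (e ▸ hκ)
        · exact Or.inr (mem_biUnion (x := κ • x) ⟨⟨κ, rfl⟩, e⟩ hκ)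
    exact fun t ht => hsub (mem_image_of_mem β ht)
  refine ⟨μ, fun N hN => ?_⟩
  -- Different `κ` may give the same orbit point, so the condition `w ∈ N` is imposed for every `κ`
  -- with `κ • x = μ • x`.
  have h := hnear (fun κ => {w | w ∈ U (κ • x) ∧ (κ • x = μ • x → w ∈ N)}) fun κ => by
    have h1 := (hU (κ • x)).2.mem_nhds (hU (κ • x)).1
    by_cases e : κ • x = μ • x
    · filter_upwards [h1, e ▸ hN] with w hw hwN using ⟨hw, fun _ => hwN⟩
    · filter_upwards [h1] with w hw using ⟨hw, fun e' => absurd e' e⟩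
  change ∀ᶠ t in l, β t ∈ N
  filter_upwards [h, hTl] with t ht htT
  obtain ⟨κ, hκ, hκN⟩ := ht
  refine hκN ?_
  by_contra e
  exact (hdisj ⟨κ, rfl⟩ ⟨μ, rfl⟩ e).le_bot ⟨hκ, hall t htT⟩

lemma IsFlowLine.exists_lift_atBot (hγ : IsFlowLine g f p q γ) (hf : O.IsMorse f)
    (hc : c ∈ O.charts) {x : E n} (hx : x ∈ c.V) (hxp : c.φ x = p) :
    ∃ s β, IsLift c γ (Iic s) β ∧ Tendsto β atBot (𝓝 x) := by
  have hev := hγ.tendsto_atBot (range_mem_nhds (c := c) ⟨x, hx, hxp⟩)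
  obtain ⟨s, hs⟩ := mem_atBot_sets.1 hev
  obtain ⟨β, hβ⟩ := hγ.exists_lift_of_isOpen hf hc ordConnected_Iio isOpen_Iio
    fun r (hr : r < s) => hs r hr.le
  obtain ⟨μ, hμ⟩ := hβ.exists_tendsto (l := atBot)
    (fun S hS => by
      obtain ⟨b, hb⟩ := mem_atBot_sets.1 hS
      exact ⟨Iic b, Iic_mem_atBot b, hb, isPreconnected_Iic⟩)
    (Iio_mem_atBot s) hx (hxp ▸ hγ.tendsto_atBot)
  -- The lift was built over an open ray, so the closed ray must be slightly shorter; `μ⁻¹` moves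
  -- its limit `μ • x` to the prescribed `x`.
  refine ⟨s - 1, _, (hβ.smul μ⁻¹).mono fun r (hr : r ≤ s - 1) => by
    simp only [mem_Iio]; linarith, ?_⟩
  have h1 : Tendsto (fun z : E n => μ⁻¹ • z) (𝓝 (μ • x)) (𝓝 x) := by
    simpa [ContinuousAt] using continuousAt_smul μ⁻¹ (c.smul_mem μ x hx)
  exact h1.comp hμ

lemma IsFlowLine.exists_lift_atTop (hγ : IsFlowLine g f p q γ) (hf : O.IsMorse f)
    (hc : c ∈ O.charts) {x : E n} (hx : x ∈ c.V) (hxq : c.φ x = q) :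
    ∃ s β, IsLift c γ (Ici s) β ∧ Tendsto β atTop (𝓝 x) := by
  have hev := hγ.tendsto_atTop (range_mem_nhds (c := c) ⟨x, hx, hxq⟩)
  obtain ⟨s, hs⟩ := mem_atTop_sets.1 hev
  obtain ⟨β, hβ⟩ := hγ.exists_lift_of_isOpen hf hc ordConnected_Ioi isOpen_Ioi
    fun r (hr : s < r) => hs r hr.le
  obtain ⟨μ, hμ⟩ := hβ.exists_tendsto (l := atTop)
    (fun S hS => by
      obtain ⟨b, hb⟩ := mem_atTop_sets.1 hS
      exact ⟨Ici b, Ici_mem_atTop b, hb, isPreconnected_Ici⟩)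
    (Ioi_mem_atTop s) hx (hxq ▸ hγ.tendsto_atTop)
  refine ⟨s + 1, _, (hβ.smul μ⁻¹).mono fun r (hr : s + 1 ≤ r) => by
    simp only [mem_Ioi]; linarith, ?_⟩
  have h1 : Tendsto (fun z : E n => μ⁻¹ • z) (𝓝 (μ • x)) (𝓝 x) := by
    simpa [ContinuousAt] using continuousAt_smul μ⁻¹ (c.smul_mem μ x hx)
  exact h1.comp hμ

/-- Far out, the stabilizer of a lift is contained in the stabilizer of its limit. -/
lemma IsFlowLine.stab_le_of_tendsto (hγ : IsFlowLine g f p q γ) (hf : O.IsMorse f)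
    (hc : c ∈ O.charts) (hI : I.OrdConnected) (hβ : IsLift c γ I β) {l : Filter ℝ} [l.NeBot]
    (hl : I ∈ l) {x : E n} (hx : x ∈ c.V) (hlim : Tendsto β l (𝓝 x)) {t : ℝ} (ht : t ∈ I) :
    c.Stab (β t) ≤ c.Stab x := by
  obtain ⟨r, hr, hrI⟩ := ((hlim.eventually (eventually_stab_le hx)).and hl).exists
  rw [hγ.stab_eq hf hc hI hβ ht hrI]
  exact hr

end Flow
end EffectiveOrbifold
end OrbifoldMorse

/-! ### Bilinear forms and the differential inequality at a critical point. -/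

namespace OrbifoldMorse

/-- Let `a` be an inner product and `B` a nondegenerate symmetric bilinear form. Then `B` is positive
on vectors that are orthogonal to all eigenvectors of `B` with negative eigenvalue. -/
lemma bilin_pos_of_orthogonal {V : Type*} [AddCommGroup V] [Module ℝ V] [FiniteDimensional ℝ V]
    (a B : V →ₗ[ℝ] V →ₗ[ℝ] ℝ) (ha : ∀ v w, a v w = a w v) (hpos : ∀ v, v ≠ 0 → 0 < a v v)
    (hB : ∀ v w, B v w = B w v) (hnd : ∀ v, (∀ w, B v w = 0) → v = 0) {u : V} (hu : u ≠ 0)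
    (horth : ∀ v, ∀ l < 0, (∀ w, B v w = l * a v w) → a u v = 0) : 0 < B u u := by
  -- With `a` as inner product, `B` becomes a symmetric operator with an orthonormal eigenbasis. In
  -- `B u u = ∑ l i * ⟨b i, u⟩²` the negative eigenvalues drop out by `horth`, and zero is excluded
  -- by nondegeneracy.
  let core : InnerProductSpace.Core ℝ V :=
    { inner := fun v w => a v w
      conj_inner_symm := fun v w => by simpa using ha w v
      re_inner_nonneg := fun v => by
        rcases eq_or_ne v 0 with rfl | h
        · simp
        · simpa using (hpos v h).le
      add_left := fun v w z => by simp
      smul_left := fun v w r => by simp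
      definite := fun v h => by
        by_contra hv
        exact (hpos v hv).ne' h }
  let : NormedAddCommGroup V := core.toNormedAddCommGroup
  let : InnerProductSpace ℝ V := InnerProductSpace.ofCore core.toCore
  have hin : ∀ v w : V, inner ℝ v w = a v w := fun _ _ => rfl
  let T : V →ₗ[ℝ] V :=
    { toFun := fun v => (InnerProductSpace.toDual ℝ V).symm (LinearMap.toContinuousLinearMap (B v))
      map_add' := fun v w => by simp
      map_smul' := fun r v => by simp }
  have hT : ∀ v w, inner ℝ (T v) w = B v w := fun v w => by
    simp [T, InnerProductSpace.toDual_symm_apply]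
  have hsymm : T.IsSymmetric := fun v w => by
    rw [hT, real_inner_comm, hT, hB]
  let b := hsymm.eigenvectorBasis rfl
  let l := hsymm.eigenvalues rfl
  have hTb : ∀ i, T (b i) = l i • b i := fun i => hsymm.apply_eigenvectorBasis rfl i
  have hBb : ∀ i w, B (b i) w = l i * a (b i) w := fun i w => by
    rw [← hT, hTb, inner_smul_left, hin]; simp
  have hl0 : ∀ i, l i ≠ 0 := fun i h => by
    have := hnd (b i) fun w => by rw [hBb, h, zero_mul]
    exact b.orthonormal.ne_zero i this
  have hsum : B u u = ∑ i, l i * (inner ℝ (b i) u) ^ 2 := by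
    rw [← hT, ← b.sum_inner_mul_inner]
    refine Finset.sum_congr rfl fun i _ => ?_
    rw [hsymm u (b i), hTb, inner_smul_right, real_inner_comm]
    ring
  have hterm : ∀ i, 0 ≤ l i * (inner ℝ (b i) u) ^ 2 := fun i => by
    rcases lt_or_gt_of_ne (hl0 i) with h | h
    · have : inner ℝ (b i) u = 0 := by
        rw [hin, ha]
        exact horth _ _ h (hBb i)
      simp [this]
    · positivity
  rw [hsum]
  refine lt_of_le_of_ne (Finset.sum_nonneg fun i _ => hterm i) fun h0 => hu ?_
  rw [eq_comm, Finset.sum_eq_zero_iff_of_nonneg fun i _ => hterm i] at h0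
  rw [← b.sum_repr' u]
  refine Finset.sum_eq_zero fun i hi => ?_
  have := h0 i hi
  rw [mul_eq_zero, or_iff_right (hl0 i), sq_eq_zero_iff] at this
  rw [this, zero_smul]

/-- A bilinear form that is positive on the range of `L` is coercive there. -/
lemma exists_coercive_on_range {V : Type*} [NormedAddCommGroup V] [NormedSpace ℝ V]
    [FiniteDimensional ℝ V] (B : V →L[ℝ] V →L[ℝ] ℝ) (L : V →L[ℝ] V)
    (h : ∀ w, L w ≠ 0 → 0 < B (L w) (L w)) :
    ∃ m > 0, ∀ w, m * ‖L w‖ ^ 2 ≤ B (L w) (L w) := by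
  let S : Set V := Metric.sphere 0 1 ∩ (LinearMap.range (L : V →ₗ[ℝ] V) : Set V)
  have hS : IsCompact S := (isCompact_sphere 0 1).inter_right (Submodule.closed_of_finiteDimensional _)
  rcases S.eq_empty_or_nonempty with hemp | hne
  · refine ⟨1, one_pos, fun w => ?_⟩
    have : L w = 0 := by
      by_contra hw
      have hmem : (‖L w‖⁻¹ • L w) ∈ S := by
        refine ⟨by simp [norm_smul, hw], ‖L w‖⁻¹ • w, by simp⟩
      rw [hemp] at hmem
      exact hmem
    simp [this]
  · have hcont : ContinuousOn (fun u => B u u) S := by fun_prop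
    obtain ⟨u, ⟨hu1, w, rfl⟩, hmin⟩ := hS.exists_isMinOn hne hcont
    have hw0 : L w ≠ 0 := by
      intro e
      have : L w ∈ Metric.sphere (0 : V) 1 := hu1
      simp [e] at this
    refine ⟨_, h w hw0, fun z => ?_⟩
    by_cases hz : L z = 0
    · simp [hz]
    have hmem : (‖L z‖⁻¹ • L z) ∈ S := by
      refine ⟨by simp [norm_smul, hz], ‖L z‖⁻¹ • z, by simp⟩
    have hle : B (L w) (L w) ≤ B (‖L z‖⁻¹ • L z) (‖L z‖⁻¹ • L z) := hmin hmem
    have hpos : 0 < ‖L z‖ := norm_pos_iff.2 hz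
    simp only [map_smul, smul_apply, smul_eq_mul] at hle
    calc B (L w) (L w) * ‖L z‖ ^ 2 ≤ (‖L z‖⁻¹ * (‖L z‖⁻¹ * B (L z) (L z))) * ‖L z‖ ^ 2 := by gcongr
      _ = B (L z) (L z) := by field_simp

/-- The differential inequality behind the uniqueness of trajectories that emanate from a critical
point in the directions on which `B` is positive. -/
lemma eventually_apply_nonpos {V : Type*} [NormedAddCommGroup V] [NormedSpace ℝ V]
    [FiniteDimensional ℝ V] (G B : V →L[ℝ] V →L[ℝ] ℝ) (L A : V →L[ℝ] V) {k : ℝ} (hk1 : 1 ≤ k)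
    (hGA : ∀ w, G (A w) w = -B w w) (hL : ∀ w, L w ≠ 0 → 0 < B (L w) (L w)) {ι : Type*}
    {l : Filter ι} {W W' : ι → V} (ho1 : (fun t => W' t - A (W t)) =o[l] W)
    (ho2 : (fun t => L (W t) + k • W t) =o[l] W) : ∀ᶠ t in l, G (W' t) (W t) ≤ 0 := by
  obtain ⟨m, hm, hcoer⟩ := exists_coercive_on_range B L hL
  have hk0 : 0 ≤ k := by linarith
  set C : ℝ := k ^ 2 * ‖G‖ + ‖B‖ * ‖L‖ + k * ‖B‖ with hC
  have hC0 : 0 ≤ C := by positivity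
  -- The bound `1 / 2` gives `‖L w‖ ≥ ‖w‖ / 2`, so coercivity yields `m / 4 * ‖w‖ ^ 2`. The other
  -- bound keeps the total error `ε * C * ‖w‖ ^ 2` below this.
  set ε : ℝ := min (1 / 2) (m / (4 * (C + 1))) with hε
  have hε0 : 0 < ε := by positivity
  have hεC : ε * C ≤ m / 4 := by
    have h1 : ε * C ≤ m / (4 * (C + 1)) * C := by gcongr; exact min_le_right _ _
    have h2 : m / (4 * (C + 1)) * C ≤ m / 4 := by
      rw [div_mul_eq_mul_div, div_le_div_iff₀ (by positivity) (by norm_num)]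
      nlinarith
    exact h1.trans h2
  filter_upwards [ho1.bound hε0, ho2.bound hε0] with t h1 h2
  generalize W t = w at h1 h2 ⊢
  generalize W' t = w' at h1 h2 ⊢
  have hLw : ‖w‖ / 2 ≤ ‖L w‖ := by
    have e1 : ‖k • w‖ ≤ ‖L w + k • w‖ + ‖L w‖ := by
      simpa using norm_sub_le (L w + k • w) (L w)
    rw [norm_smul, Real.norm_of_nonneg hk0] at e1
    have e2 : ‖w‖ ≤ k * ‖w‖ := le_mul_of_one_le_left (norm_nonneg _) hk1
    have e3 : ε * ‖w‖ ≤ 1 / 2 * ‖w‖ := by gcongr; exact min_le_left _ _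
    linarith
  -- Substitute `k • w = (L w + k • w) - L w` into `-B (k • w) (k • w)`: the main term is `-B (L w)
  -- (L w)`, and every other term contains a small factor.
  have hid : k ^ 2 * G w' w = k ^ 2 * G (w' - A w) w + B (L w + k • w) (L w)
      - B (k • w) (L w + k • w) - B (L w) (L w) := by
    simp only [map_sub, map_add, map_smul, sub_apply,
      add_apply, smul_apply, smul_eq_mul, hGA w]
    ring
  have b1 : G (w' - A w) w ≤ ‖G‖ * (ε * ‖w‖) * ‖w‖ :=
    (le_abs_self _).trans ((G.le_opNorm₂ _ _).trans (by gcongr))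
  have b2 : B (L w + k • w) (L w) ≤ ‖B‖ * (ε * ‖w‖) * (‖L‖ * ‖w‖) :=
    (le_abs_self _).trans ((B.le_opNorm₂ _ _).trans (by gcongr; exact L.le_opNorm w))
  have b3 : -B (k • w) (L w + k • w) ≤ ‖B‖ * (k * ‖w‖) * (ε * ‖w‖) := by
    refine (neg_le_abs _).trans ((B.le_opNorm₂ _ _).trans ?_)
    rw [norm_smul, Real.norm_of_nonneg hk0]
    gcongr
  have b4 : m * (‖w‖ / 2) ^ 2 ≤ B (L w) (L w) := le_trans (by gcongr) (hcoer w)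
  have b5 : ε * C * ‖w‖ ^ 2 ≤ m / 4 * ‖w‖ ^ 2 := by gcongr
  have b6 : k ^ 2 * G (w' - A w) w ≤ k ^ 2 * (‖G‖ * (ε * ‖w‖) * ‖w‖) := by gcongr
  have hle : k ^ 2 * G w' w ≤ 0 := by
    rw [hid]
    have : k ^ 2 * (‖G‖ * (ε * ‖w‖) * ‖w‖) + ‖B‖ * (ε * ‖w‖) * (‖L‖ * ‖w‖) +
        ‖B‖ * (k * ‖w‖) * (ε * ‖w‖) = ε * C * ‖w‖ ^ 2 := by rw [hC]; ring
    nlinarith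
  exact nonpos_of_mul_nonpos_right hle (by positivity)

variable {X : Type*} [TopologicalSpace X] {n : ℕ}

/-- The isomorphism of stabilizers induced by an embedding of charts. -/
noncomputable def ChartEmbedding.stabEquiv {c d : OrbifoldChart X n} (j : ChartEmbedding c d)
    {x : E n} (hx : x ∈ c.V) : c.Stab x ≃* d.Stab (j.ψ x) :=
  MulEquiv.ofBijective
    ((j.θ.comp (c.Stab x).subtype).codRestrict (d.Stab (j.ψ x)) fun μ => j.θ_mem_stab hx μ.2)
    ⟨fun μ ν h => Subtype.ext (j.injective_θ (congrArg Subtype.val h)), fun ν => by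
      obtain ⟨μ, hμ, h⟩ := j.exists_θ_eq hx ν.2
      exact ⟨⟨μ, hμ⟩, Subtype.ext h⟩⟩

namespace EffectiveOrbifold

open OrbifoldChart ChartEmbedding

variable {O : EffectiveOrbifold X n} {f : X → ℝ} {c d : OrbifoldChart X n}

/-! ### The Hessian and stability in arbitrary charts. -/

section Hessian

lemma fderiv_rep_embed (hf : O.IsMorse f) (hd : d ∈ O.charts) (j : ChartEmbedding c d) {x : E n}
    (hx : x ∈ c.V) :
    fderiv ℝ (rep c f) x = (fderiv ℝ (rep d f) (j.ψ x)).comp (fderiv ℝ j.ψ x) := by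
  have he : rep c f =ᶠ[𝓝 x] rep d f ∘ j.ψ := by
    filter_upwards [c.isOpen_V.mem_nhds hx] with y hy
    exact congrArg f (j.comp_eq y hy).symm
  have hdiff : DifferentiableAt ℝ (rep d f) (j.ψ x) :=
    ((hf d hd).1.contDiffAt (d.isOpen_V.mem_nhds (j.mapsTo hx))).differentiableAt (by simp)
  rw [he.fderiv_eq]
  exact (hdiff.hasFDerivAt.comp x (j.hasStrictFDerivAt hx).hasFDerivAt).fderiv

lemma fderiv_rep_eq_zero_iff (hf : O.IsMorse f) (hd : d ∈ O.charts) (j : ChartEmbedding c d)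
    {x : E n} (hx : x ∈ c.V) :
    fderiv ℝ (rep c f) x = 0 ↔ fderiv ℝ (rep d f) (j.ψ x) = 0 := by
  rw [fderiv_rep_embed hf hd j hx]
  refine ⟨fun h => ?_, fun h => by rw [h, ContinuousLinearMap.zero_comp]⟩
  ext v
  obtain ⟨u, rfl⟩ := j.surjective_fderiv hx v
  exact DFunLike.congr_fun h u

/-- The chain rule for second derivatives has an extra term, the first derivative of `f` applied to
the second derivative of `ψ`; it vanishes at a critical point. -/
lemma hess_embed (hf : O.IsMorse f) (hd : d ∈ O.charts) (j : ChartEmbedding c d) {x : E n}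
    (hx : x ∈ c.V) (hcrit : fderiv ℝ (rep d f) (j.ψ x) = 0) (v w : E n) :
    hess c f x v w = hess d f (j.ψ x) (fderiv ℝ j.ψ x v) (fderiv ℝ j.ψ x w) := by
  have he : fderiv ℝ (rep c f) =ᶠ[𝓝 x]
      fun y => (fderiv ℝ (rep d f) (j.ψ y)).comp (fderiv ℝ j.ψ y) := by
    filter_upwards [c.isOpen_V.mem_nhds hx] with y hy using fderiv_rep_embed hf hd j hy
  have h1 : DifferentiableAt ℝ (fderiv ℝ (rep d f)) (j.ψ x) :=
    (((hf d hd).1.contDiffAt (d.isOpen_V.mem_nhds (j.mapsTo hx))).fderiv_right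
      (m := 1) (by norm_num)).differentiableAt (by simp)
  have h2 : DifferentiableAt ℝ (fderiv ℝ j.ψ) x :=
    ((j.contDiffAt hx).fderiv_right (m := 1)
      (by rw [one_add_one_eq_two]; exact WithTop.coe_le_coe.2 le_top)).differentiableAt (by simp)
  have h3 := (h1.hasFDerivAt.comp x (j.hasStrictFDerivAt hx).hasFDerivAt).clm_comp h2.hasFDerivAt
  rw [hess, he.fderiv_eq]
  have h4 := h3.fderiv
  simp only [Function.comp_def] at h4
  rw [h4]
  simp [hcrit, hess]

lemma hess_symm (hf : O.IsMorse f) (hc : c ∈ O.charts) {x : E n} (hx : x ∈ c.V) (v w : E n) :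
    hess c f x v w = hess c f x w v :=
  (((hf c hc).1.contDiffAt (c.isOpen_V.mem_nhds hx)).isSymmSndFDerivAt (by simp)) v w

lemma fderiv_rep_eq_zero (hf : O.IsMorse f) {p : X} (hp : O.IsCritical f p) (hc : c ∈ O.charts)
    {x : E n} (hx : x ∈ c.V) (hxp : c.φ x = p) : fderiv ℝ (rep c f) x = 0 := by
  obtain ⟨d, hd, y, hy, hyp, hcrit⟩ := hp
  obtain ⟨e, he, j, k, z, hz, rfl, rfl⟩ := O.exists_refinement hc hd hx hy (hxp.trans hyp.symm)
  rwa [← fderiv_rep_eq_zero_iff hf hc j hz, fderiv_rep_eq_zero_iff hf hd k hz]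

/-- The sum of the operators `dμ - 1` over the stabilizer of `x`. -/
noncomputable def stabDefect (c : OrbifoldChart X n) (x : E n) : E n →L[ℝ] E n :=
  ∑ᶠ μ : c.Stab x, (c.dsmul (μ : c.Γ) x - ContinuousLinearMap.id ℝ (E n))

/-- The Hessian is positive on the moving part of the isotropy representation at `x`. -/
def IsStableLift (c : OrbifoldChart X n) (f : X → ℝ) (x : E n) : Prop :=
  ∀ w, stabDefect c x w ≠ 0 → 0 < hess c f x (stabDefect c x w) (stabDefect c x w)

lemma dsmul_embed (j : ChartEmbedding c d) {x : E n} (hx : x ∈ c.V) {μ : c.Γ} (hμ : μ ∈ c.Stab x)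
    (w : E n) :
    fderiv ℝ j.ψ x (c.dsmul μ x w) = d.dsmul (j.θ μ) (j.ψ x) (fderiv ℝ j.ψ x w) := by
  have hμx : μ • x = x := hμ
  have he : (j.ψ ∘ fun z : E n => μ • z) =ᶠ[𝓝 x] (fun z : E n => j.θ μ • z) ∘ j.ψ := by
    filter_upwards [c.isOpen_V.mem_nhds hx] with y hy using j.equivariant μ y hy
  have h1 := (hasStrictFDerivAt_smul (j.θ μ) (j.mapsTo hx)).hasFDerivAt.comp x
    (j.hasStrictFDerivAt hx).hasFDerivAt
  have h2 : HasFDerivAt j.ψ (fderiv ℝ j.ψ x) (μ • x) := by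
    rw [hμx]
    exact (j.hasStrictFDerivAt hx).hasFDerivAt
  have h3 := h2.comp x (hasStrictFDerivAt_smul μ hx).hasFDerivAt
  exact DFunLike.congr_fun (h3.unique (h1.congr_of_eventuallyEq he)) w

lemma stabDefect_embed (j : ChartEmbedding c d) {x : E n} (hx : x ∈ c.V) (w : E n) :
    fderiv ℝ j.ψ x (stabDefect c x w) = stabDefect d (j.ψ x) (fderiv ℝ j.ψ x w) := by
  let := Fintype.ofFinite (c.Stab x)
  let := Fintype.ofFinite (d.Stab (j.ψ x))
  rw [stabDefect, stabDefect, finsum_eq_sum_of_fintype, finsum_eq_sum_of_fintype,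
    ← Equiv.sum_comp (j.stabEquiv hx).toEquiv]
  simp only [sum_apply, map_sum]
  refine Finset.sum_congr rfl fun μ _ => ?_
  simp only [sub_apply, map_sub, ContinuousLinearMap.id_apply,
    dsmul_embed j hx μ.2]
  rfl

lemma isStableLift_embed (hf : O.IsMorse f) (hd : d ∈ O.charts) (j : ChartEmbedding c d) {x : E n}
    (hx : x ∈ c.V) (hcrit : fderiv ℝ (rep d f) (j.ψ x) = 0) :
    IsStableLift c f x ↔ IsStableLift d f (j.ψ x) := by
  have h0 : ∀ w, stabDefect c x w = 0 ↔ stabDefect d (j.ψ x) (fderiv ℝ j.ψ x w) = 0 := fun w => by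
    rw [← stabDefect_embed j hx]
    exact ((j.immersion x hx).eq_iff' (map_zero _)).symm
  unfold IsStableLift
  conv_rhs => rw [(j.surjective_fderiv hx).forall]
  refine forall_congr' fun w => ?_
  rw [hess_embed hf hd j hx hcrit, stabDefect_embed j hx, ne_eq, h0]

/-- A negative eigenvector `v` is fixed by every `dμ`, so invariance gives `a (dμ w - w) v = 0`: the
moving part is orthogonal to all such `v`, where the Hessian is positive. Stability is given in one
chart only; a common refinement carries it to any other. -/
lemma IsStableAt.isStableLift (hf : O.IsMorse f) {p : X} (hp : O.IsCritical f p)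
    (hs : O.IsStableAt f p) (hc : c ∈ O.charts) {x : E n} (hx : x ∈ c.V) (hxp : c.φ x = p) :
    IsStableLift c f x := by
  obtain ⟨d, hd, y, hy, hyp, a, ha, hinv, htriv⟩ := hs
  have hyc := fderiv_rep_eq_zero hf hp hd hy hyp
  have hxc := fderiv_rep_eq_zero hf hp hc hx hxp
  have hstab : IsStableLift d f y := by
    intro w hw
    let toL : (E n →L[ℝ] E n →L[ℝ] ℝ) → (E n →ₗ[ℝ] E n →ₗ[ℝ] ℝ) := fun b =>
      (ContinuousLinearMap.coeLM ℝ).comp (b : E n →ₗ[ℝ] E n →L[ℝ] ℝ)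
    refine bilin_pos_of_orthogonal (toL a) (toL (hess d f y)) ha.1 ha.2 (hess_symm hf hd hy)
      ((hf d hd).2 y hy hyc) hw fun v l hl hv => ?_
    have hfix : ∀ μ ∈ d.Stab y, d.dsmul μ y v = v := fun μ hμ =>
      htriv μ hμ v (Submodule.subset_span ⟨l, hl, hv⟩)
    change a (stabDefect d y w) v = 0
    let := Fintype.ofFinite (d.Stab y)
    rw [stabDefect, finsum_eq_sum_of_fintype]
    simp only [sum_apply, map_sum]
    refine Finset.sum_eq_zero fun μ _ => ?_
    have := hinv μ μ.2 w v
    rw [hfix μ μ.2] at this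
    simp [this]
  obtain ⟨e, he, j, k, z, hz, rfl, rfl⟩ := O.exists_refinement hc hd hx hy (hxp.trans hyp.symm)
  rwa [← isStableLift_embed hf hc j hz hxc, isStableLift_embed hf hd k hz hyc]

end Hessian

/-! ### Rigidity of trajectories leaving a stable critical point. -/

section Unstable

lemma IsInnerProduct.eq_zero_of_tendsto_atBot {G : E n →L[ℝ] E n →L[ℝ] ℝ} (hG : IsInnerProduct G)
    {W W' : ℝ → E n} {t₁ : ℝ} (hW : ∀ t ≤ t₁, HasDerivAt W (W' t) t)
    (hneg : ∀ t ≤ t₁, G (W' t) (W t) ≤ 0) (hW0 : Tendsto W atBot (𝓝 0)) : W t₁ = 0 := by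
  have hh : ∀ t ≤ t₁, HasDerivAt (fun t => G (W t) (W t)) (G (W' t) (W t) + G (W t) (W' t)) t :=
    fun t ht => (G.hasFDerivAt.comp_hasDerivAt t (hW t ht)).clm_apply (hW t ht)
  have hanti : AntitoneOn (fun t => G (W t) (W t)) (Iic t₁) := by
    refine antitoneOn_of_deriv_nonpos (convex_Iic _)
      (fun t ht => (hh t ht).continuousAt.continuousWithinAt)
      (fun t ht => (hh t (interior_subset (s := Iic t₁) ht)).differentiableAt.differentiableWithinAt)
      fun t ht => ?_
    have ht' : t ≤ t₁ := interior_subset (s := Iic t₁) ht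
    rw [(hh t ht').deriv, hG.1 (W t)]
    have := hneg t ht'
    linarith
  have hlim0 : Tendsto (fun t => G (W t) (W t)) atBot (𝓝 0) := by
    have hcont : Continuous fun w : E n => G w w := by fun_prop
    simpa [Function.comp_def] using (hcont.tendsto 0).comp hW0
  have hle : G (W t₁) (W t₁) ≤ 0 := by
    refine ge_of_tendsto hlim0 ?_
    filter_upwards [Iic_mem_atBot t₁] with t ht using hanti ht self_mem_Iic ht
  by_contra hne
  exact absurd (hG.2 _ hne) (not_lt.2 hle)

variable {g : O.RiemannianMetric} {p q : X} {γ : ℝ → X}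

lemma negGrad_eq_zero {x : E n} (hcrit : fderiv ℝ (rep c f) x = 0) : negGrad g f c x = 0 := by
  simp [negGrad, hcrit]

/-- Differentiate the equation defining the gradient; the derivative of the metric drops out because
the gradient vanishes at `x`. -/
lemma inner_fderiv_negGrad (hf : O.IsMorse f) (hc : c ∈ O.charts) {x : E n} (hx : x ∈ c.V)
    (hcrit : fderiv ℝ (rep c f) x = 0) (v w : E n) :
    g.inner c x (fderiv ℝ (negGrad g f c) x v) w = -hess c f x v w := by
  have he : (fun y => g.inner c y (negGrad g f c y)) =ᶠ[𝓝 x] fun y => -(fderiv ℝ (rep c f) y) := by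
    filter_upwards [c.isOpen_V.mem_nhds hx] with y hy using inner_negGrad hc hy
  have h1 : HasFDerivAt (fderiv ℝ (rep c f)) (hess c f x) x :=
    ((((hf c hc).1.contDiffAt (c.isOpen_V.mem_nhds hx)).fderiv_right
      (m := 1) (by norm_num)).differentiableAt (by simp)).hasFDerivAt
  have h2 : DifferentiableAt ℝ (g.inner c) x :=
    ((g.contDiffOn c hc).contDiffAt (c.isOpen_V.mem_nhds hx)).differentiableAt (by simp)
  have h3 : DifferentiableAt ℝ (negGrad g f c) x :=
    (contDiffAt_negGrad hf hc hx).differentiableAt (by simp)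
  have h4 := (h2.hasFDerivAt.clm_apply h3.hasFDerivAt).unique (h1.neg.congr_of_eventuallyEq he)
  have h5 := DFunLike.congr_fun (DFunLike.congr_fun h4 v) w
  simpa [negGrad_eq_zero hcrit] using h5

/-- Write `W = μα - α`. Reindexing by `ν ↦ νμ` gives `∑ ν(μα) = ∑ να`, and linearizing each term
gives `∑ dν W = o(W)`. Subtracting `W` once per element of the stabilizer says that `W` lies in the
moving part to first order. -/
lemma stabDefect_add_isLittleO {ι : Type*} {l : Filter ι} {x : E n} (hx : x ∈ c.V) {μ : c.Γ}
    (hμ : μ ∈ c.Stab x) {α : ι → E n} (hpair : Tendsto (fun t => (μ • α t, α t)) l (𝓝 (x, x))) :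
    (fun t => stabDefect c x (μ • α t - α t) + (Nat.card (c.Stab x) : ℝ) • (μ • α t - α t)) =o[l]
      fun t => μ • α t - α t := by
  let := Fintype.ofFinite (c.Stab x)
  have h : (fun t => ∑ ν : c.Stab x,
      (ν.1 • μ • α t - ν.1 • α t - c.dsmul ν.1 x (μ • α t - α t))) =o[l] fun t => μ • α t - α t :=
    Asymptotics.IsLittleO.fun_sum fun ν _ =>
      (hasStrictFDerivAt_smul ν.1 hx).isLittleO.comp_tendsto hpair
  refine h.neg_left.congr_left fun t => ?_
  have e1 : ∑ ν : c.Stab x, ν.1 • μ • α t = ∑ ν : c.Stab x, ν.1 • α t := by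
    rw [← Equiv.sum_comp (Equiv.mulRight (⟨μ, hμ⟩ : c.Stab x)) fun ν : c.Stab x => ν.1 • α t]
    refine Finset.sum_congr rfl fun ν _ => ?_
    exact (mul_smul ν.1 μ (α t)).symm
  rw [Finset.sum_sub_distrib, Finset.sum_sub_distrib, e1, stabDefect, finsum_eq_sum_of_fintype,
    sum_apply]
  generalize μ • α t - α t = w
  simp only [sub_apply, Finset.sum_sub_distrib, ContinuousLinearMap.id_apply, Finset.sum_const,
    Finset.card_univ, Nat.card_eq_fintype_card, Nat.cast_smul_eq_nsmul]
  abel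

/-- A lift of a flow line that emanates from a stable critical point is fixed by the stabilizer of
that point. -/
lemma IsFlowLine.stab_le_of_tendsto_atBot (hγ : IsFlowLine g f p q γ) (hf : O.IsMorse f)
    (hc : c ∈ O.charts) {x : E n} (hx : x ∈ c.V) (hcrit : fderiv ℝ (rep c f) x = 0)
    (hstab : IsStableLift c f x) {s : ℝ} {α : ℝ → E n} (hα : IsLift c γ (Iic s) α)
    (hlim : Tendsto α atBot (𝓝 x)) : c.Stab x ≤ c.Stab (α s) := by
  intro μ hμ
  have hμx : μ • x = x := hμ
  have hμα : Tendsto (fun t => μ • α t) atBot (𝓝 x) := by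
    have := continuousAt_smul μ hx
    rw [ContinuousAt, hμx] at this
    exact this.comp hlim
  have hpair : Tendsto (fun t => (μ • α t, α t)) atBot (𝓝 (x, x)) := hμα.prodMk_nhds hlim
  have ho1 := ((contDiffAt_negGrad (g := g) hf hc hx).hasStrictFDerivAt
    one_ne_zero).isLittleO.comp_tendsto hpair
  simp only [Function.comp_def] at ho1
  have hk1 : (1 : ℝ) ≤ Nat.card (c.Stab x) := by exact_mod_cast Nat.card_pos
  -- Applied to `W = μα - α`, with `A` the linearized gradient field at `x`, `L` the stabilizer
  -- defect and `k` the order of the stabilizer.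
  obtain ⟨t₁, ht₁⟩ := mem_atBot_sets.1 ((eventually_apply_nonpos (g.inner c x) (hess c f x) _ _ hk1
    (fun w => inner_fderiv_negGrad hf hc hx hcrit w w) hstab ho1
    (stabDefect_add_isLittleO hx hμ hpair)).and (Iio_mem_atBot s))
  have hW0 : Tendsto (fun t => μ • α t - α t) atBot (𝓝 0) := by simpa using hμα.sub hlim
  have hderiv : ∀ t < s, HasDerivAt (fun t => μ • α t - α t)
      (negGrad g f c (μ • α t) - negGrad g f c (α t)) t :=
    fun t ht => (hγ.hasDerivAt hc (hα.smul μ) (Iic_mem_nhds ht)).sub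
      (hγ.hasDerivAt hc hα (Iic_mem_nhds ht))
  have hWz := IsInnerProduct.eq_zero_of_tendsto_atBot (g.isInnerProduct c hc x hx)
    (fun t ht => hderiv t (ht₁ t ht).2) (fun t ht => (ht₁ t ht).1) hW0
  have hts : t₁ ∈ Iic s := (le_of_lt (ht₁ t₁ le_rfl).2)
  rw [← hγ.stab_eq hf hc ordConnected_Iic hα hts self_mem_Iic]
  exact sub_eq_zero.1 hWz

end Unstable

end EffectiveOrbifold


namespace EffectiveOrbifold

open OrbifoldChart ChartEmbedding

/-! ### Correspondence of labelled stabilizers in different charts. -/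

section Corr

variable {R : Type} {O : EffectiveOrbifold X n} {b c d : OrbifoldChart X n}

/-- The families `ρ` in `Stab(x)` and `σ` in `Stab(y)` correspond to each other under a pair of
embeddings of a common chart that sends a point to `x` and `y`. -/
def Corr (O : EffectiveOrbifold X n) (x : E n) (ρ : R → c.Γ) (y : E n) (σ : R → d.Γ) : Prop :=
  ∃ e ∈ O.charts, ∃ (j : ChartEmbedding e c) (k : ChartEmbedding e d), ∃ z ∈ e.V, ∃ κ : R → e.Γ,
    j.ψ z = x ∧ k.ψ z = y ∧ (∀ r, κ r ∈ e.Stab z) ∧ (∀ r, j.θ (κ r) = ρ r) ∧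
      ∀ r, k.θ (κ r) = σ r

variable {x y : E n} {ρ : R → c.Γ} {σ : R → d.Γ}

lemma Corr.symm (h : O.Corr x ρ y σ) : O.Corr y σ x ρ := by
  obtain ⟨e, he, j, k, z, hz, κ, h1, h2, h3, h4, h5⟩ := h
  exact ⟨e, he, k, j, z, hz, κ, h2, h1, h3, h5, h4⟩

lemma Corr.mem_left (h : O.Corr x ρ y σ) (r : R) : ρ r ∈ c.Stab x := by
  obtain ⟨e, he, j, k, z, hz, κ, rfl, h2, h3, h4, h5⟩ := h
  exact h4 r ▸ j.θ_mem_stab hz (h3 r)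

lemma Corr.mem_right (h : O.Corr x ρ y σ) (r : R) : σ r ∈ d.Stab y := h.symm.mem_left r

lemma Corr.of_embed (hc : c ∈ O.charts) (hx : x ∈ c.V) (hρ : ∀ r, ρ r ∈ c.Stab x)
    (j : ChartEmbedding c d) : O.Corr x ρ (j.ψ x) fun r => j.θ (ρ r) :=
  ⟨c, hc, ChartEmbedding.refl c, j, x, hx, ρ, rfl, rfl, hρ, fun _ => rfl, fun _ => rfl⟩

lemma Corr.rfl' (hc : c ∈ O.charts) (hx : x ∈ c.V) (hρ : ∀ r, ρ r ∈ c.Stab x) :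
    O.Corr x ρ x ρ :=
  Corr.of_embed hc hx hρ (ChartEmbedding.refl c)

lemma Corr.range_eq (h : O.Corr x ρ y σ) (hρ : range ρ = c.Stab x) : range σ = d.Stab y := by
  refine Subset.antisymm (range_subset_iff.2 h.mem_right) fun ν hν => ?_
  obtain ⟨e, he, j, k, z, hz, κ, rfl, rfl, h3, h4, h5⟩ := h
  obtain ⟨μ, hμ, rfl⟩ := k.exists_θ_eq hz hν
  have : j.θ μ ∈ range ρ := hρ ▸ j.θ_mem_stab hz hμ
  obtain ⟨r, hr⟩ := this
  refine ⟨r, ?_⟩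
  rw [← h5, j.injective_θ ((h4 r).trans hr)]

/-- The two small charts both embed in the middle chart with a common value; their common refinement
there, made compatible on groups, relates the outer two. -/
lemma Corr.trans {w : E n} {τ : R → b.Γ} (h : O.Corr x ρ y σ)
    (h' : O.Corr y σ w τ) : O.Corr x ρ w τ := by
  obtain ⟨e, he, j, k, z, hz, κ, rfl, rfl, h3, h4, h5⟩ := h
  obtain ⟨e', he', j', k', z', hz', κ', h1', rfl, h3', h4', h5'⟩ := h'
  obtain ⟨i, hi, l, m, u, hu, rfl, rfl, hθ⟩ := O.exists_pullback he he' k j' hz hz' h1'.symm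
  choose κ'' hκ'' hl using fun r => l.exists_θ_eq hu (h3 r)
  have hm : ∀ r, m.θ (κ'' r) = κ' r := fun r => by
    apply j'.injective_θ
    rw [← hθ, hl, h5, h4']
  exact ⟨i, hi, j.comp l, k'.comp m, u, hu, κ'', rfl, rfl, hκ'',
    fun r => by rw [comp_θ, hl, h4], fun r => by rw [comp_θ, hm, h5']⟩

lemma Corr.exists (hc : c ∈ O.charts) (hd : d ∈ O.charts) (hx : x ∈ c.V) (hy : y ∈ d.V)
    (hxy : c.φ x = d.φ y) (hρ : ∀ r, ρ r ∈ c.Stab x) : ∃ σ : R → d.Γ, O.Corr x ρ y σ := by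
  obtain ⟨e, he, j, k, z, hz, rfl, rfl⟩ := O.exists_refinement hc hd hx hy hxy
  choose κ hκ hj using fun r => j.exists_θ_eq hz (hρ r)
  exact ⟨fun r => k.θ (κ r), e, he, j, k, z, hz, κ, rfl, rfl, hκ, hj, fun _ => rfl⟩

lemma Corr.conj (hd : d ∈ O.charts) (hy : y ∈ d.V) (h : O.Corr x ρ y σ) {ν : d.Γ}
    (hν : ν ∈ d.Stab y) : O.Corr x ρ y fun r => ν * σ r * ν⁻¹ := by
  have hν' : (ofElement ν).ψ y = y := hν
  have h' := Corr.of_embed hd hy h.mem_right (ofElement ν)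
  rw [hν'] at h'
  exact h.trans h'

/-- Over a refinement on which the embeddings into the first chart agree, those into the second
differ by a group element, which fixes `y`. This is the only ambiguity in changing charts. -/
lemma Corr.exists_conj {σ' : R → d.Γ} (h : O.Corr x ρ y σ)
    (h' : O.Corr x ρ y σ') : ∃ ν ∈ d.Stab y, ∀ r, σ' r = ν * σ r * ν⁻¹ := by
  obtain ⟨e, he, j, k, z, hz, κ, rfl, rfl, h3, h4, h5⟩ := h
  obtain ⟨e', he', j', k', z', hz', κ', h1', h2', h3', h4', h5'⟩ := h'
  obtain ⟨i, hi, l, m, u, hu, rfl, rfl, hθ⟩ := O.exists_pullback he he' j j' hz hz' h1'.symm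
  obtain ⟨ν, hν, hνθ⟩ := (k.comp l).exists_eq_smul (k'.comp m)
  refine ⟨ν, ?_, fun r => ?_⟩
  · have := hν u hu
    rw [comp_ψ, comp_ψ, h2'] at this
    exact this.symm
  · obtain ⟨μ, hμ, hl⟩ := l.exists_θ_eq hu (h3 r)
    have hm : m.θ μ = κ' r := by
      apply j'.injective_θ
      rw [← hθ, hl, h4, h4']
    have := hνθ μ
    rwa [comp_θ, comp_θ, hl, hm, h5, h5'] at this

variable {g : O.RiemannianMetric} {f : X → ℝ} {p q : X} {γ : ℝ → X} {I : Set ℝ}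

/-- Lift `γ` through `z` in the small chart. By uniqueness its images are the given lifts, and its
constant stabilizer keeps the witnesses valid nearby. -/
lemma IsFlowLine.eventually_corr (hγ : IsFlowLine g f p q γ) (hf : O.IsMorse f) (hc : c ∈ O.charts)
    (hd : d ∈ O.charts) (hI : I.OrdConnected) {β β' : ℝ → E n} (hβ : IsLift c γ I β)
    (hβ' : IsLift d γ I β') {r : ℝ} (hr : r ∈ I) (h : O.Corr (β r) ρ (β' r) σ) :
    ∀ᶠ t in 𝓝[I] r, O.Corr (β t) ρ (β' t) σ := by
  obtain ⟨e, he, j, k, z, hz, κ, h1, h2, h3, h4, h5⟩ := h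
  obtain ⟨ε, hε, δ, hδ, rfl⟩ := hγ.exists_lift_through he hz
    (((j.comp_eq z hz).symm.trans (congrArg c.φ h1)).trans (hβ.2 r hr).2)
  have hI' : (I ∩ Ioo (r - ε) (r + ε)).OrdConnected := hI.inter ordConnected_Ioo
  have hrε : r ∈ Ioo (r - ε) (r + ε) := by simp [hε]
  have hrI : r ∈ I ∩ Ioo (r - ε) (r + ε) := ⟨hr, hrε⟩
  have hδ' := hδ.mono (inter_subset_right (s := I))
  have e1 := hγ.eqOn_of_ordConnected hf hc hI' (hδ'.embed j) (hβ.mono inter_subset_left) hrI h1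
  have e2 := hγ.eqOn_of_ordConnected hf hd hI' (hδ'.embed k) (hβ'.mono inter_subset_left) hrI h2
  filter_upwards [inter_mem_nhdsWithin I (Ioo_mem_nhds hrε.1 hrε.2)] with t ht
  exact ⟨e, he, j, k, δ t, (hδ.2 t ht.2).1, κ, e1 ht, e2 ht,
    fun u => hγ.stab_eq hf he ordConnected_Ioo hδ hrε ht.2 ▸ h3 u, h4, h5⟩

lemma IsFlowLine.corr_of_corr (hγ : IsFlowLine g f p q γ) (hf : O.IsMorse f) (hc : c ∈ O.charts)
    (hd : d ∈ O.charts) (hI : I.OrdConnected) {β β' : ℝ → E n} (hβ : IsLift c γ I β)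
    (hβ' : IsLift d γ I β') {s t : ℝ} (hs : s ∈ I) (ht : t ∈ I)
    (h : O.Corr (β s) ρ (β' s) σ) : O.Corr (β t) ρ (β' t) σ := by
  have hρ : ∀ u ∈ I, ∀ r, ρ r ∈ c.Stab (β u) := fun u hu r =>
    hγ.stab_eq hf hc hI hβ hs hu ▸ h.mem_left r
  refine (hI.isPreconnected.induction₂'
    (fun u v => O.Corr (β u) ρ (β' u) σ ↔ O.Corr (β v) ρ (β' v) σ) (fun u hu => ?_)
    (fun _ _ _ _ _ _ => Iff.trans) hs ht).1 h
  suffices h : ∀ᶠ v in 𝓝[I] u, (O.Corr (β u) ρ (β' u) σ ↔ O.Corr (β v) ρ (β' v) σ) from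
    h.mono fun v hv => ⟨hv, hv.symm⟩
  -- Failure of the relation must be open too. Some `σ₁` corresponds to `ρ` at `u`, hence nearby; if
  -- `σ` did so at a nearby `v`, it would be conjugate to `σ₁` by an element stabilizing `β' v`,
  -- hence `β' u`, and would already correspond at `u`.
  obtain ⟨σ₁, hσ₁⟩ := Corr.exists hc hd (hβ.mapsTo hu) (hβ'.mapsTo hu)
    ((hβ.2 u hu).2.trans (hβ'.2 u hu).2.symm) (hρ u hu)
  by_cases hu' : O.Corr (β u) ρ (β' u) σ
  · filter_upwards [hγ.eventually_corr hf hc hd hI hβ hβ' hu hu'] with v hv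
    exact ⟨fun _ => hv, fun _ => hu'⟩
  · filter_upwards [hγ.eventually_corr hf hc hd hI hβ hβ' hu hσ₁, self_mem_nhdsWithin] with v hv hvI
    refine ⟨fun h => absurd h hu', fun h => ?_⟩
    obtain ⟨ν, hν, hνσ⟩ := hv.exists_conj h
    have hν' : ν ∈ d.Stab (β' u) := hγ.stab_eq hf hd hI hβ' hvI hu ▸ hν
    have := hσ₁.conj hd (hβ'.mapsTo hu) hν'
    rwa [← funext hνσ] at this

end Corr

/-! ### Potentials: trivializing the stabilizers over an interval. -/

section Potential

variable {O : EffectiveOrbifold X n} {γ : ℝ → X} {R : Type}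

/-- A coherent choice over the times in `I` of parametrizations of the stabilizers of the lifts of
`γ`, unique up to inner automorphisms. -/
structure IsPotential (I : Set ℝ) (S : ∀ a : LiftPoint O γ, Set (R → a.chart.Γ)) : Prop where
  range_eq : ∀ a, a.time ∈ I → ∀ ρ ∈ S a, range ρ = (a.Stab : Set a.chart.Γ)
  nonempty : ∀ a, a.time ∈ I → (S a).Nonempty
  exists_conj : ∀ a, a.time ∈ I → ∀ ρ ∈ S a, ∀ σ ∈ S a, ∃ ν ∈ a.Stab, ∀ r, σ r = ν * ρ r * ν⁻¹
  corr : ∀ a b : LiftPoint O γ, a.time ∈ I → a.time = b.time → ∀ ρ ∈ S a, ∀ σ,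
    O.Corr a.pt ρ b.pt σ → σ ∈ S b
  along : ∀ (c : OrbifoldChart X n) (hc : c ∈ O.charts) (s t : ℝ) (hst : s ≤ t) (β : ℝ → E n)
    (hβ : IsLift c γ (Icc s t) β), s ∈ I → t ∈ I →
    ∀ ρ ∈ S (LiftPoint.ofLift hc hβ s (left_mem_Icc.2 hst)),
      ρ ∈ S (LiftPoint.ofLift hc hβ t (right_mem_Icc.2 hst))

variable {I : Set ℝ} {S : ∀ a : LiftPoint O γ, Set (R → a.chart.Γ)}

lemma IsPotential.mem_stab (h : IsPotential I S) {a : LiftPoint O γ} (ha : a.time ∈ I)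
    {ρ : R → a.chart.Γ} (hρ : ρ ∈ S a) (r : R) : ρ r ∈ a.Stab := by
  have : ρ r ∈ (a.Stab : Set a.chart.Γ) := h.range_eq a ha ρ hρ ▸ mem_range_self r
  exact this

lemma IsPotential.conj_mem (h : IsPotential I S) {a : LiftPoint O γ} (ha : a.time ∈ I)
    {ρ : R → a.chart.Γ} (hρ : ρ ∈ S a) {ν : a.chart.Γ} (hν : ν ∈ a.Stab) :
    (fun r => ν * ρ r * ν⁻¹) ∈ S a :=
  h.corr a a ha rfl ρ hρ _
    ((Corr.rfl' a.chart_mem a.pt_mem (h.mem_stab ha hρ)).conj a.chart_mem a.pt_mem hν)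

variable {g : O.RiemannianMetric} {f : X → ℝ} {p q : X}

/-- Potentials are only required to move forward in time. Backwards, any labelling at `s` arrives at
`t` conjugate to `ρ`, and the conjugating element also stabilizes `β s`, so the conjugation can be
made there. -/
lemma IsFlowLine.isPotential_along_symm (hγ : IsFlowLine g f p q γ) (hf : O.IsMorse f)
    (h : IsPotential I S) {c : OrbifoldChart X n} (hc : c ∈ O.charts) {s t : ℝ} (hst : s ≤ t)
    {β : ℝ → E n} (hβ : IsLift c γ (Icc s t) β) (hs : s ∈ I) (ht : t ∈ I) {ρ : R → c.Γ}
    (hρ : ρ ∈ S (LiftPoint.ofLift hc hβ t (right_mem_Icc.2 hst))) :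
    ρ ∈ S (LiftPoint.ofLift hc hβ s (left_mem_Icc.2 hst)) := by
  obtain ⟨ρ₁, hρ₁⟩ : ∃ ρ₁ : R → c.Γ, ρ₁ ∈ S (LiftPoint.ofLift hc hβ s (left_mem_Icc.2 hst)) :=
    h.nonempty (LiftPoint.ofLift hc hβ s (left_mem_Icc.2 hst)) hs
  obtain ⟨ν, hν, hνρ⟩ : ∃ ν ∈ c.Stab (β t), ∀ r, ρ r = ν * ρ₁ r * ν⁻¹ :=
    h.exists_conj _ ht _ (h.along c hc s t hst β hβ hs ht _ hρ₁) _ hρ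
  have hν' : ν ∈ c.Stab (β s) := hγ.stab_eq hf hc ordConnected_Icc hβ (right_mem_Icc.2 hst)
    (left_mem_Icc.2 hst) ▸ hν
  have h₁ : (fun r => ν * ρ₁ r * ν⁻¹) ∈ S (LiftPoint.ofLift hc hβ s (left_mem_Icc.2 hst)) :=
    h.conj_mem (a := LiftPoint.ofLift hc hβ s (left_mem_Icc.2 hst)) hs hρ₁ hν'
  rwa [← funext hνρ] at h₁

lemma IsPotential.single (a₀ : LiftPoint O γ) :
    IsPotential (O := O) (γ := γ) (Icc a₀.time a₀.time)
      fun a => {ρ : a₀.Stab → a.chart.Γ | O.Corr a₀.pt (fun μ : a₀.Stab => (μ : a₀.chart.Γ))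
        a.pt ρ} where
  range_eq a _ ρ hρ := hρ.range_eq Subtype.range_coe
  nonempty a ha := by
    have ha' : a.time = a₀.time := by simpa using ha
    exact Corr.exists a₀.chart_mem a.chart_mem a₀.pt_mem a.pt_mem
      (by rw [a₀.φ_pt, a.φ_pt, ha']) fun μ => μ.2
  exists_conj a _ ρ hρ σ hσ := hρ.exists_conj hσ
  corr a b _ _ ρ hρ σ hσ := hρ.trans hσ
  along c hc s t hst β hβ hs ht ρ hρ := by
    obtain rfl : s = t := by
      rw [Icc_self, mem_singleton_iff] at hs ht
      rw [hs, ht]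
    exact hρ

/-- A potential extends over an interval on which the path has a lift. -/
lemma IsFlowLine.isPotential_extend (hγ : IsFlowLine g f p q γ) (hf : O.IsMorse f) {A B C : ℝ}
    (hAB : A ≤ B) (hBC : B ≤ C) (h : IsPotential (Icc A B) S) {c : OrbifoldChart X n}
    (hc : c ∈ O.charts) {β : ℝ → E n} (hβ : IsLift c γ (Icc B C) β) :
    -- Beyond `B` the labels are those at `β B`, carried unchanged along `β` and then passed to
    -- other charts by `Corr`.
    IsPotential (Icc A C) fun a : LiftPoint O γ => {ρ : R → a.chart.Γ | (a.time ≤ B ∧ ρ ∈ S a) ∨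
      (B < a.time ∧ ∃ ρ₀ : R → c.Γ, ρ₀ ∈ S (LiftPoint.ofLift hc hβ B (left_mem_Icc.2 hBC)) ∧
        O.Corr (β a.time) ρ₀ a.pt ρ)} := by
  have hB : B ∈ Icc A B := right_mem_Icc.2 hAB
  have hBC' : B ∈ Icc B C := left_mem_Icc.2 hBC
  have hstab : ∀ {t}, t ∈ Icc B C → c.Stab (β B) = c.Stab (β t) := fun ht =>
    hγ.stab_eq hf hc ordConnected_Icc hβ hBC' ht
  constructor
  · rintro a ha ρ (⟨h1, h2⟩ | ⟨h1, ρ₀, hρ₀, h2⟩)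
    · exact h.range_eq a ⟨ha.1, h1⟩ ρ h2
    · have h3 : range ρ₀ = (c.Stab (β B) : Set c.Γ) := h.range_eq _ hB _ hρ₀
      exact h2.range_eq (hstab ⟨h1.le, ha.2⟩ ▸ h3)
  · intro a ha
    rcases le_or_gt a.time B with h1 | h1
    · obtain ⟨ρ, hρ⟩ := h.nonempty a ⟨ha.1, h1⟩
      exact ⟨ρ, Or.inl ⟨h1, hρ⟩⟩
    · obtain ⟨ρ₀, hρ₀⟩ : ∃ ρ₀ : R → c.Γ, ρ₀ ∈ S (LiftPoint.ofLift hc hβ B hBC') :=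
        h.nonempty (LiftPoint.ofLift hc hβ B hBC') hB
      have hm : ∀ r, ρ₀ r ∈ c.Stab (β B) := h.mem_stab hB hρ₀
      have ht : a.time ∈ Icc B C := ⟨h1.le, ha.2⟩
      obtain ⟨ρ, hρ⟩ := Corr.exists hc a.chart_mem (hβ.mapsTo ht) a.pt_mem
        ((hβ.2 _ ht).2.trans a.φ_pt.symm) fun r => hstab ht ▸ hm r
      exact ⟨ρ, Or.inr ⟨h1, ρ₀, hρ₀, hρ⟩⟩
  · rintro a ha ρ (⟨h1, h2⟩ | ⟨h1, ρ₀, hρ₀, h2⟩) σ (⟨k1, k2⟩ | ⟨k1, σ₀, hσ₀, k2⟩)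
    · exact h.exists_conj a ⟨ha.1, h1⟩ ρ h2 σ k2
    · exact absurd h1 (not_le.2 k1)
    · exact absurd k1 (not_le.2 h1)
    · have ht : a.time ∈ Icc B C := ⟨h1.le, ha.2⟩
      obtain ⟨ν, hν, hνσ⟩ : ∃ ν ∈ c.Stab (β B), ∀ r, ρ₀ r = ν * σ₀ r * ν⁻¹ :=
        h.exists_conj _ hB _ hσ₀ _ hρ₀
      have hν' : ν ∈ c.Stab (β a.time) := hstab ht ▸ hν
      have := (k2.symm.conj hc (hβ.mapsTo ht) hν').symm
      rw [← funext hνσ] at this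
      exact h2.exists_conj this
  · rintro a b ha hab ρ (⟨h1, h2⟩ | ⟨h1, ρ₀, hρ₀, h2⟩) σ hσ
    · exact Or.inl ⟨hab ▸ h1, h.corr a b ⟨ha.1, h1⟩ hab ρ h2 σ hσ⟩
    · exact Or.inr ⟨hab ▸ h1, ρ₀, hρ₀, hab ▸ h2.trans hσ⟩
  · rintro d hd s t hst δ hδ hs ht ρ (⟨h1, h2⟩ | ⟨h1, ρ₀, hρ₀, h2⟩)
    · have h1' : s ≤ B := h1
      rcases le_or_gt t B with h3 | h3
      · exact Or.inl ⟨h3, h.along d hd s t hst δ hδ ⟨hs.1, h1⟩ ⟨ht.1, h3⟩ ρ h2⟩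
      · refine Or.inr ⟨h3, ?_⟩
        have hδB := hδ.mono (Icc_subset_Icc_right h3.le)
        have hδt := hδ.mono (Icc_subset_Icc_left h1')
        have hρB := h.along d hd s B h1' δ hδB ⟨hs.1, h1⟩ hB ρ h2
        have hBmem : B ∈ Icc s t := ⟨h1', h3.le⟩
        obtain ⟨ρ₀, hρ₀⟩ := Corr.exists (c := d) (d := c) (ρ := ρ) hd hc (hδ.mapsTo hBmem)
          (hβ.mapsTo hBC') ((hδ.2 B hBmem).2.trans (hβ.2 B hBC').2.symm)
          fun r => h.mem_stab hB hρB r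
        refine ⟨ρ₀, h.corr (LiftPoint.ofLift hd hδB B (right_mem_Icc.2 h1'))
          (LiftPoint.ofLift hc hβ B hBC') hB rfl _ hρB _ hρ₀, ?_⟩
        exact hγ.corr_of_corr hf hc hd ordConnected_Icc (hβ.mono (Icc_subset_Icc_right ht.2)) hδt
          (left_mem_Icc.2 h3.le) (right_mem_Icc.2 h3.le) hρ₀.symm
    · have h1' : B < s := h1
      refine Or.inr ⟨h1'.trans_le hst, ρ₀, hρ₀, ?_⟩
      exact hγ.corr_of_corr hf hc hd ordConnected_Icc (hβ.mono (Icc_subset_Icc h1'.le ht.2)) hδ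
        (left_mem_Icc.2 hst) (right_mem_Icc.2 hst) h2

lemma IsFlowLine.exists_isPotential (hγ : IsFlowLine g f p q γ) (hf : O.IsMorse f) {A B : ℝ}
    (hAB : A ≤ B) : ∃ (R : Type) (S : ∀ a : LiftPoint O γ, Set (R → a.chart.Γ)),
      IsPotential (Icc A B) S := by
  obtain ⟨c₀, hc₀, x₀, hx₀, hφ₀⟩ := O.covers (γ A)
  let a₀ : LiftPoint O γ := ⟨c₀, hc₀, A, x₀, hx₀, hφ₀⟩
  have key := Icc_chain_induction (a := A) (b := B)
    -- Phrasing extension from `s` to `t` as an implication makes it additive in the interval. The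
    -- label set is always the stabilizer at the initial lift.
    (P := fun s t => (∃ S : ∀ a : LiftPoint O γ, Set (a₀.Stab → a.chart.Γ),
      IsPotential (Icc A s) S) → ∃ S : ∀ a : LiftPoint O γ, Set (a₀.Stab → a.chart.Γ),
      IsPotential (Icc A t) S) hAB ?_ fun _ _ _ _ _ _ _ h1 h2 h => h2 (h1 h)
  · obtain ⟨S, hS⟩ := key ⟨_, IsPotential.single a₀⟩
    exact ⟨_, S, hS⟩
  · intro r _
    obtain ⟨c, hc, hr⟩ := O.covers (γ r)
    obtain ⟨ε, hε, β, hβ⟩ := hγ.exists_lift c hc r hr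
    refine ⟨ε, hε, fun s t hs hst _ hs' ht' => ?_⟩
    rintro ⟨S, hS⟩
    exact ⟨_, hγ.isPotential_extend hf hs hst hS hc (hβ.mono (Icc_subset_Ioo hs'.1 ht'.2))⟩

/-- Transports along a flow line preserve potentials. -/
lemma IsFlowLine.isPotential_transport (hγ : IsFlowLine g f p q γ) (hf : O.IsMorse f)
    {a b : LiftPoint O γ} {e : a.Stab ≃* b.Stab} (he : IsTransport O γ a b e) :
    -- A transport may wander through times outside those of its endpoints, so the potential must
    -- live on a window large enough for all intermediate lifts.
    ∃ N : ℝ, ∀ M, N ≤ M → a.time ∈ Icc (-M) M ∧ b.time ∈ Icc (-M) M ∧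
      ∀ (R : Type) (S : ∀ a : LiftPoint O γ, Set (R → a.chart.Γ)), IsPotential (Icc (-M) M) S →
        ∀ ρ σ, (∀ r, ∃ h : ρ r ∈ a.Stab, (e ⟨ρ r, h⟩ : b.chart.Γ) = σ r) →
          (ρ ∈ S a ↔ σ ∈ S b) := by
  induction he with
  | along c hc s t hst β hβ e he =>
    refine ⟨max |s| |t|, fun M hM => ?_⟩
    have hs : s ∈ Icc (-M) M := abs_le.1 ((le_max_left _ _).trans hM)
    have ht : t ∈ Icc (-M) M := abs_le.1 ((le_max_right _ _).trans hM)
    refine ⟨hs, ht, fun R S hS ρ σ hρσ => ?_⟩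
    obtain rfl : σ = ρ := funext fun r => by
      obtain ⟨h, h'⟩ := hρσ r
      exact h'.symm.trans (he _)
    exact ⟨hS.along c hc s t hst β hβ hs ht _, hγ.isPotential_along_symm hf hS hc hst hβ hs ht⟩
  | embed a d hd j e he =>
    refine ⟨|a.time|, fun M hM => ?_⟩
    have ha : a.time ∈ Icc (-M) M := abs_le.1 hM
    refine ⟨ha, ha, fun R S hS ρ σ hρσ => ?_⟩
    obtain rfl : σ = fun r => j.θ (ρ r) := funext fun r => by
      obtain ⟨h, h'⟩ := hρσ r
      exact h'.symm.trans (he _)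
    have hcorr : O.Corr a.pt ρ (j.ψ a.pt) fun r => j.θ (ρ r) :=
      Corr.of_embed a.chart_mem a.pt_mem (fun r => (hρσ r).1) j
    exact ⟨fun h => hS.corr a (a.map hd j) ha rfl ρ h _ hcorr,
      fun h => hS.corr (a.map hd j) a ha rfl _ h ρ hcorr.symm⟩
  | symm _ ih =>
    obtain ⟨N, hN⟩ := ih
    refine ⟨N, fun M hM => ⟨(hN M hM).2.1, (hN M hM).1, fun R S hS ρ σ hρσ => ?_⟩⟩
    refine ((hN M hM).2.2 R S hS σ ρ fun r => ?_).symm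
    obtain ⟨h, h'⟩ := hρσ r
    refine ⟨h' ▸ Subtype.prop _, ?_⟩
    simp [← h']
  | @trans a b c e e' _ _ ih ih' =>
    obtain ⟨N, hN⟩ := ih
    obtain ⟨N', hN'⟩ := ih'
    refine ⟨max N N', fun M hM => ?_⟩
    have h1 := hN M ((le_max_left _ _).trans hM)
    have h2 := hN' M ((le_max_right _ _).trans hM)
    refine ⟨h1.1, h2.2.1, fun R S hS ρ τ hρτ => ?_⟩
    choose h h' using hρτ
    exact (h1.2.2 R S hS ρ (fun r => e ⟨ρ r, h r⟩) fun r => ⟨h r, rfl⟩).trans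
      (h2.2.2 R S hS _ τ fun r => ⟨Subtype.prop _, h' r⟩)

end Potential

/-! ### Existence of transports. -/

section Transport

variable {O : EffectiveOrbifold X n} {γ : ℝ → X} {g : O.RiemannianMetric} {f : X → ℝ} {p q : X}

lemma exists_isTransport_of_time_eq (a b : LiftPoint O γ) (h : a.time = b.time) :
    ∃ e, IsTransport O γ a b e := by
  obtain ⟨c, hc, s, x, hx, hxs⟩ := a
  obtain ⟨d, hd, t, y, hy, hyt⟩ := b
  obtain rfl : s = t := h
  obtain ⟨e, he, j, k, z, hz, rfl, rfl⟩ := O.exists_refinement hc hd hx hy (hxs.trans hyt.symm)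
  let w : LiftPoint O γ := ⟨e, he, s, z, hz, (j.comp_eq z hz).symm.trans hxs⟩
  exact ⟨_, (IsTransport.embed w c hc j (j.stabEquiv hz) fun _ => rfl).symm.trans
    (IsTransport.embed w d hd k (k.stabEquiv hz) fun _ => rfl)⟩

lemma IsFlowLine.exists_isTransport_of_isLift (hγ : IsFlowLine g f p q γ) (hf : O.IsMorse f)
    {c : OrbifoldChart X n} (hc : c ∈ O.charts) {I : Set ℝ} (hI : I.OrdConnected) {β : ℝ → E n}
    (hβ : IsLift c γ I β) {s t : ℝ} (hs : s ∈ I) (ht : t ∈ I) :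
    ∃ e, IsTransport O γ (LiftPoint.ofLift hc hβ s hs) (LiftPoint.ofLift hc hβ t ht) e := by
  have key : ∀ {s t : ℝ} (hs : s ∈ I) (ht : t ∈ I), s ≤ t →
      ∃ e, IsTransport O γ (LiftPoint.ofLift hc hβ s hs) (LiftPoint.ofLift hc hβ t ht) e :=
    fun hs ht hst => ⟨_, IsTransport.along c hc _ _ hst β (hβ.mono (hI.out hs ht))
      (MulEquiv.subgroupCongr (hγ.stab_eq hf hc hI hβ hs ht)) fun _ => rfl⟩
  rcases le_total s t with h | h
  · exact key hs ht h
  · obtain ⟨e, he⟩ := key ht hs h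
    exact ⟨_, he.symm⟩

/-- The stabilizers of any two lifts of points of a flow line are related by a transport. -/
lemma IsFlowLine.exists_isTransport (hγ : IsFlowLine g f p q γ) (hf : O.IsMorse f)
    (a b : LiftPoint O γ) : ∃ e, IsTransport O γ a b e := by
  refine isPreconnected_univ.induction₂' (s := (univ : Set ℝ))
    (fun s t => ∀ a b : LiftPoint O γ, a.time = s → b.time = t → ∃ e, IsTransport O γ a b e)
    (fun r _ => ?_) (fun r s t _ _ _ h1 h2 a b ha hb => ?_) (mem_univ a.time) (mem_univ b.time)
    a b rfl rfl
  · obtain ⟨c, hc, hr⟩ := O.covers (γ r)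
    obtain ⟨ε, hε, β, hβ⟩ := hγ.exists_lift c hc r hr
    have hrε : r ∈ Ioo (r - ε) (r + ε) := by simp [hε]
    rw [nhdsWithin_univ]
    filter_upwards [Ioo_mem_nhds hrε.1 hrε.2] with t ht
    have key : ∀ a b : LiftPoint O γ, a.time = r → b.time = t → ∃ e, IsTransport O γ a b e := by
      intro a b ha hb
      obtain ⟨e₁, h₁⟩ := exists_isTransport_of_time_eq a (LiftPoint.ofLift hc hβ r hrε) ha
      obtain ⟨e₂, h₂⟩ := hγ.exists_isTransport_of_isLift hf hc ordConnected_Ioo hβ hrε ht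
      obtain ⟨e₃, h₃⟩ := exists_isTransport_of_time_eq (LiftPoint.ofLift hc hβ t ht) b hb.symm
      exact ⟨_, (h₁.trans h₂).trans h₃⟩
    exact ⟨key, fun a b ha hb => by
      obtain ⟨e, he⟩ := key b a hb ha
      exact ⟨_, he.symm⟩⟩
  · obtain ⟨c, hc, x, hx, hxs⟩ := O.covers (γ s)
    obtain ⟨e₁, h₁⟩ := h1 a ⟨c, hc, s, x, hx, hxs⟩ ha rfl
    obtain ⟨e₂, h₂⟩ := h2 ⟨c, hc, s, x, hx, hxs⟩ b rfl hb
    exact ⟨_, h₁.trans h₂⟩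

end Transport

/-! ### The induced homomorphism and its uniqueness up to conjugation. -/

section Induced

variable {O : EffectiveOrbifold X n} {γ : ℝ → X} {g : O.RiemannianMetric} {f : X → ℝ} {p q : X}
  {c d : OrbifoldChart X n} {x y : E n}

lemma IsFlowLine.exists_isInducedBy (hγ : IsFlowLine g f p q γ) (hf : O.IsStableMorse f)
    (hp : O.IsCritical f p) (hc : c ∈ O.charts) (hd : d ∈ O.charts) (hx : x ∈ c.V)
    (hxp : c.φ x = p) (hy : y ∈ d.V) (hyq : d.φ y = q) :
    ∃ ι : c.Stab x →* d.Stab y, Function.Injective ι ∧ O.IsInducedBy γ hc hd ι := by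
  obtain ⟨s, α, hα, hαx⟩ := hγ.exists_lift_atBot hf.1 hc hx hxp
  obtain ⟨t, β, hβ, hβy⟩ := hγ.exists_lift_atTop hf.1 hd hy hyq
  have h : c.Stab x = c.Stab (α s) := le_antisymm
    (hγ.stab_le_of_tendsto_atBot hf.1 hc hx (fderiv_rep_eq_zero hf.1 hp hc hx hxp)
      ((hf.2 p hp).isStableLift hf.1 hp hc hx hxp) hα hαx)
    (hγ.stab_le_of_tendsto hf.1 hc ordConnected_Iic hα (Iic_mem_atBot s) hx hαx self_mem_Iic)
  have h' : d.Stab (β t) ≤ d.Stab y :=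
    hγ.stab_le_of_tendsto hf.1 hd ordConnected_Ici hβ (Ici_mem_atTop t) hy hβy self_mem_Ici
  obtain ⟨e, he⟩ := hγ.exists_isTransport hf.1 (LiftPoint.ofLift hc hα s self_mem_Iic)
    (LiftPoint.ofLift hd hβ t self_mem_Ici)
  let e' : c.Stab (α s) ≃* d.Stab (β t) := e
  refine ⟨(Subgroup.inclusion h').comp
    (e'.toMonoidHom.comp (MulEquiv.subgroupCongr h).toMonoidHom), ?_, s, t, α, β, hα, hβ, hαx, hβy,
    h, e', he, fun μ => rfl⟩
  exact (Subgroup.inclusion_injective h').comp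
    (e'.injective.comp (MulEquiv.subgroupCongr h).injective)

lemma IsFlowLine.exists_conj_of_isInducedBy (hγ : IsFlowLine g f p q γ) (hf : O.IsMorse f)
    (hc : c ∈ O.charts) (hd : d ∈ O.charts) (hx : x ∈ c.V) (hy : y ∈ d.V)
    {ι ι' : c.Stab x →* d.Stab y} (hι : O.IsInducedBy γ hc hd ι) (hι' : O.IsInducedBy γ hc hd ι') :
    ∃ ν : d.Stab y, ∀ μ, ι' μ = ν * ι μ * ν⁻¹ := by
  obtain ⟨s, t, α, β, hα, hβ, hαx, hβy, h, e, he, hιe⟩ := hι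
  obtain ⟨s', t', α', β', hα', hβ', hαx', hβy', h', e', he', hιe'⟩ := hι'
  set s₀ := min s s' with hs₀
  set T := max t t' with hT
  have hs : s₀ ∈ Iic s := min_le_left s s'
  have hs' : s₀ ∈ Iic s' := min_le_right s s'
  have ht : T ∈ Ici t := le_max_left t t'
  have ht' : T ∈ Ici t' := le_max_right t t'
  have hstab : c.Stab x = c.Stab (α s₀) :=
    h.trans (hγ.stab_eq hf hc ordConnected_Iic hα self_mem_Iic hs)
  -- The two lifts differ by some `μ`, which fixes their common limit `x`. Since `Stab(x) = Stab(α
  -- s₀)`, it fixes the lift too: there is no ambiguity at the source.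
  have hαα' : α s₀ = α' s₀ := by
    obtain ⟨μ, hμ⟩ := hα.exists_smul_eq hα' hs hs'
    have heq := hγ.eqOn_of_ordConnected hf hc ordConnected_Iic
      ((hα.mono (Iic_subset_Iic.2 hs)).smul μ) (hα'.mono (Iic_subset_Iic.2 hs')) self_mem_Iic hμ
    have hμx : μ • x = x := tendsto_nhds_unique
      (((continuousAt_smul μ hx).tendsto.comp hαx).congr'
        (by filter_upwards [Iic_mem_atBot s₀] with r hr using heq hr)) hαx'
    have hμα : μ ∈ c.Stab (α s₀) := hstab ▸ hμx
    exact (show μ • α s₀ = α s₀ from hμα).symm.trans hμ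
  obtain ⟨κ, hκ⟩ := hβ.exists_smul_eq hβ' ht ht'
  -- At the target `κ` also fixes the limit, but need not fix the lift, so it contributes a
  -- conjugation in `Stab(y)`.
  have hκy : κ ∈ d.Stab y := by
    have heq := hγ.eqOn_of_ordConnected hf hd ordConnected_Ici
      ((hβ.mono (Ici_subset_Ici.2 ht)).smul κ) (hβ'.mono (Ici_subset_Ici.2 ht')) self_mem_Ici hκ
    exact tendsto_nhds_unique (((continuousAt_smul κ hy).tendsto.comp hβy).congr'
        (by filter_upwards [Ici_mem_atTop T] with r hr using heq hr)) hβy'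
  obtain ⟨N, hN⟩ := hγ.isPotential_transport hf he
  obtain ⟨N', hN'⟩ := hγ.isPotential_transport hf he'
  set M := max (max N N') (max |s₀| |T|) with hM
  obtain ⟨hsM, htM, hact⟩ := hN M ((le_max_left _ _).trans (le_max_left _ _))
  obtain ⟨hsM', htM', hact'⟩ := hN' M ((le_max_right _ _).trans (le_max_left _ _))
  have hs₀M : s₀ ∈ Icc (-M) M := abs_le.1 ((le_max_left _ _).trans (le_max_right _ _))
  have hTM : T ∈ Icc (-M) M := abs_le.1 ((le_max_right _ _).trans (le_max_right _ _))
  obtain ⟨R, S, hS⟩ := hγ.exists_isPotential hf (hs₀M.1.trans hs₀M.2)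
  obtain ⟨ρ, hρ⟩ : ∃ ρ : R → c.Γ, ρ ∈ S (LiftPoint.ofLift hc hα s₀ hs) :=
    hS.nonempty (LiftPoint.ofLift hc hα s₀ hs) hs₀M
  have hρmem : ∀ r, ρ r ∈ c.Stab (α s₀) := hS.mem_stab hs₀M hρ
  have hρ' : ρ ∈ S (LiftPoint.ofLift hc hα' s₀ hs') := by
    refine hS.corr (LiftPoint.ofLift hc hα s₀ hs) (LiftPoint.ofLift hc hα' s₀ hs') hs₀M rfl ρ hρ ρ ?_
    change O.Corr (α s₀) ρ (α' s₀) ρ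
    rw [← hαα']
    exact Corr.rfl' hc (hα.mapsTo hs) hρmem
  have h1 : ∀ r, ρ r ∈ c.Stab (α s) := fun r => h ▸ hstab ▸ hρmem r
  have h1' : ∀ r, ρ r ∈ c.Stab (α' s') := fun r => h' ▸ hstab ▸ hρmem r
  have k1 : (fun r => (e ⟨ρ r, h1 r⟩ : d.Γ)) ∈ S (LiftPoint.ofLift hd hβ T ht) :=
    hS.along d hd t T ht β (hβ.mono Icc_subset_Ici_self) htM hTM _
      ((hact R S hS ρ _ fun r => ⟨h1 r, rfl⟩).1
        (hS.along c hc s₀ s hs α (hα.mono Icc_subset_Iic_self) hs₀M hsM _ hρ))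
  have k1' : (fun r => (e' ⟨ρ r, h1' r⟩ : d.Γ)) ∈ S (LiftPoint.ofLift hd hβ' T ht') :=
    hS.along d hd t' T ht' β' (hβ'.mono Icc_subset_Ici_self) htM' hTM _
      ((hact' R S hS ρ _ fun r => ⟨h1' r, rfl⟩).1
        (hS.along c hc s₀ s' hs' α' (hα'.mono Icc_subset_Iic_self) hs₀M hsM' _ hρ'))
  -- The images of `ρ` under both transports now lie in the potential at the same lift, so they are
  -- conjugate.
  have k2 : (fun r => κ * (e ⟨ρ r, h1 r⟩ : d.Γ) * κ⁻¹) ∈ S (LiftPoint.ofLift hd hβ' T ht') := by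
    refine hS.corr (LiftPoint.ofLift hd hβ T ht) (LiftPoint.ofLift hd hβ' T ht') hTM rfl _ k1 _ ?_
    change O.Corr (β T) _ (β' T) _
    rw [← hκ]
    exact Corr.of_embed hd (hβ.mapsTo ht) (hS.mem_stab hTM k1) (ofElement κ)
  obtain ⟨ν, hν, hνe⟩ : ∃ ν ∈ d.Stab (β' T), ∀ r, (e' ⟨ρ r, h1' r⟩ : d.Γ) =
      ν * (κ * (e ⟨ρ r, h1 r⟩ : d.Γ) * κ⁻¹) * ν⁻¹ := hS.exists_conj _ hTM _ k2 _ k1'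
  have hνy : ν ∈ d.Stab y :=
    hγ.stab_le_of_tendsto hf hd ordConnected_Ici hβ' (Ici_mem_atTop t') hy hβy' ht' hν
  refine ⟨⟨ν, hνy⟩ * ⟨κ, hκy⟩, fun μ => Subtype.ext ?_⟩
  -- The labelling exhausts the stabilizer, so conjugacy on labels is conjugacy of the two
  -- homomorphisms.
  have hμ : (μ : c.Γ) ∈ range ρ := by
    rw [show range ρ = (c.Stab (α s₀) : Set c.Γ) from
      hS.range_eq (LiftPoint.ofLift hc hα s₀ hs) hs₀M ρ hρ, ← hstab]
    exact μ.2
  obtain ⟨r, hr⟩ := hμ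
  have hfin := hνe r
  simp only [hr] at hfin
  simp only [Subgroup.coe_mul, Subgroup.coe_inv, hιe, hιe', hfin, mul_inv_rev, mul_assoc]

end Induced

end EffectiveOrbifold

end OrbifoldMorse

theorem mainTheorem7 {X : Type*} [TopologicalSpace X] [T2Space X] [ParacompactSpace X] {n : ℕ}
    (O : OrbifoldMorse.EffectiveOrbifold X n) (f : X → ℝ) (hf : O.IsStableMorse f)
    (g : O.RiemannianMetric) (p q : X) (hp : O.IsCritical f p) (hq : O.IsCritical f q)
    (c d : OrbifoldMorse.OrbifoldChart X n) (hc : c ∈ O.charts) (hd : d ∈ O.charts)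
    (x y : OrbifoldMorse.E n) (hx : x ∈ c.V) (hxp : c.φ x = p) (hy : y ∈ d.V) (hyq : d.φ y = q) :
    (∀ γ : ℝ → X, OrbifoldMorse.EffectiveOrbifold.IsFlowLine g f p q γ →
      (∃ ι : c.Stab x →* d.Stab y, Function.Injective ι ∧ O.IsInducedBy γ hc hd ι) ∧
      (∀ ι ι' : c.Stab x →* d.Stab y, O.IsInducedBy γ hc hd ι → O.IsInducedBy γ hc hd ι' →
        ∃ ν : d.Stab y, ∀ μ, ι' μ = ν * ι μ * ν⁻¹) ∧
      Nat.card (c.Stab x) ∣ Nat.card (d.Stab y)) ∧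
    (Finite (OrbifoldMorse.EffectiveOrbifold.Moduli g f p q) →
      ∀ o : OrbifoldMorse.EffectiveOrbifold.Moduli g f p q → ℤˣ,
        ∃ k : ℤ, OrbifoldMorse.EffectiveOrbifold.invariantCoeff g f p q c d x y o = k) := by

  have hι : ∀ γ : ℝ → X, OrbifoldMorse.EffectiveOrbifold.IsFlowLine g f p q γ →
      ∃ ι : c.Stab x →* d.Stab y, Function.Injective ι ∧ O.IsInducedBy γ hc hd ι :=
    fun γ hγ => hγ.exists_isInducedBy hf hp hc hd hx hxp hy hyq
  have hdvd : ∀ γ : ℝ → X, OrbifoldMorse.EffectiveOrbifold.IsFlowLine g f p q γ →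
      Nat.card (c.Stab x) ∣ Nat.card (d.Stab y) := fun γ hγ => by
    obtain ⟨ι, hinj, -⟩ := hι γ hγ
    exact Subgroup.card_dvd_of_injective ι hinj
  refine ⟨fun γ hγ => ⟨hι γ hγ, fun ι ι' h h' =>
    hγ.exists_conj_of_isInducedBy hf.1 hc hd hx hy h h', hdvd γ hγ⟩, fun hfin o => ?_⟩
  have := Fintype.ofFinite (OrbifoldMorse.EffectiveOrbifold.Moduli g f p q)
  rw [OrbifoldMorse.EffectiveOrbifold.invariantCoeff, finsum_eq_sum_of_fintype]
  -- Divisibility needs a flow line; without one the sum is empty.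
  rcases isEmpty_or_nonempty (OrbifoldMorse.EffectiveOrbifold.Moduli g f p q) with hemp | ⟨⟨γ, hγ⟩⟩
  · exact ⟨0, by simp⟩
  · obtain ⟨k, hk⟩ := hdvd γ hγ
    have hne : (Nat.card (c.Stab x) : ℚ) ≠ 0 := by exact_mod_cast Nat.card_pos.ne'
    refine ⟨∑ m, (o m : ℤ) * k, ?_⟩
    rw [hk]
    push_cast
    simp only [mul_div_cancel_left₀ _ hne]
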